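/- Let $\alpha$ be an infinite set and let $G$ be the semigroup (under composition) of all finite transformations of $\alpha$, i.e. maps $\tau:\alpha\to\alpha$ with $\{i:\tau(i)\ne i\}$ finite. A \emph{polyadic Heyting algebra} of dimension $\alpha$ ($GPHA_\alpha$) is an algebra $(A,\vee,\wedge,\to,0,\mathsf s_\tau,\mathsf c_{(J)},\mathsf q_{(J)})_{\tau\in G,\ J\subseteq\alpha\text{ finite}}$ such that $(A,\vee,\wedge,\to,0)$ is a Heyting algebra, each $\mathsf s_\tau$ is a Heyting endomorphism, each $\mathsf c_{(J)}$ is an existential quantifier ($\exists 0=0$, $p\le\exists p$, $\exists(p\wedge\exists r)=\exists p\wedge\exists r$, $\exists(\exists p\to\exists r)=\exists p\to\exists r$, $\exists(\exists p\vee\exists r)=\exists p\vee\exists r$, $\exists\exists p=\exists p$), each $\mathsf q_{(J)}$ is a universal quantifier ($\forall 1=1$, $\forall p\le p$, $\forall(p\to r)\le\forall p\to\forall r$, $\forall\forall p=\forall p$), and for all $p\in A$, $\sigma,\tau\in G$ and finite $J,J'\subseteq\alpha$: (1) $\mathsf s_{Id}p=p$; (2) $\mathsf s_{\sigma\circ\tau}p=\mathsf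 s_\sigma\mathsf s_\tau p$; (3) $\mathsf c_{(J\cup J')}p=\mathsf c_{(J)}\mathsf c_{(J')}p$ and $\mathsf q_{(J\cup J')}p=\mathsf q_{(J)}\mathsf q_{(J')}p$; (4) $\mathsf c_{(J)}\mathsf q_{(J)}p=\mathsf q_{(J)}p$ and $\mathsf q_{(J)}\mathsf c_{(J)}p=\mathsf c_{(J)}p$; (5) if $\sigma$ and $\tau$ agree on $\alpha\setminus J$, then $\mathsf s_\sigma\mathsf c_{(J)}p=\mathsf s_\tau\mathsf c_{(J)}p$ and $\mathsf s_\sigma\mathsf q_{(J)}p=\mathsf s_\tau\mathsf q_{(J)}p$; (6) if $\sigma$ is injective on $\sigma^{-1}(J)$, then $\mathsf c_{(J)}\mathsf s_\sigma p=\mathsf s_\sigma\mathsf c_{(\sigma^{-1}(J))}p$ and $\mathsf q_{(J)}\mathsf s_\sigma p=\mathsf s_\sigma\mathsf q_{(\sigma^{-1}(J))}p$. A \emph{polyadic Heyting algebra with equality} ($GPHAE_\alpha$) has in addition constants $\mathsf d_{kl}$ $(k,l\in\alpha)$ with $\mathsf d_{kk}=1$, $\mathsf s_\tau\mathsf d_{kl}=\mathsf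 d_{\tau(k)\tau(l)}$ and $p\wedge\mathsf d_{kl}\le\mathsf s_{[k|l]}p$ for all $p$, where $[k|l]$ sends $k$ to $l$ and fixes all other points. Let $L$ be $GPHA_\alpha$ or $GPHAE_\alpha$, let $\delta$ be an index set and let $\rho$ assign to each $\eta\in\delta$ a subset $\rho(\eta)\subseteq\alpha$ such that $\alpha\setminus\bigcup_{\eta\in S}\rho(\eta)$ is infinite for every finite $S\subseteq\delta$. Let $\mathfrak{Fr}$ be the absolutely free algebra of the similarity type of $L$ generated by $\delta$. The \emph{dimension-restricted free algebra} $\mathfrak A=\mathfrak{Fr}^{\rho}_{\delta}L$ is the quotient of $\mathfrak{Fr}$ by the intersection of all congruences $R$ such that $\mathfrak{Fr}/R\in L$ and $\mathsf c_{(\{k\})}\eta/R=\eta/R$ for all $\eta\in\delta$ and $k\in\alpha\setminus\rho(\eta)$. Let $X\subseteq A$ be the set of images of the generators $\eta\in\delta$. For $Y\subseteq A$ let $\mathfrak{Sg}\,Y$ be the subalgebra of $\mathfrak A$ generated by $Y$ (with respect to all operations of the type), and let $a\le b$ mean $a\wedge b=a$. \textbf{Theorem.} $\mathfrak A$ has the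 interpolation property: for all $X_1,X_2\subseteq X$ and all $\theta_1\in\mathfrak{Sg}\,X_1$, $\theta_2\in\mathfrak{Sg}\,X_2$ with $\theta_1\le\theta_2$, there is $\theta\in\mathfrak{Sg}(X_1\cap X_2)$ such that $\theta_1\le\theta\le\theta_2$. -/

import Mathlib

universe u v

/-- The finite transformations of `α` (maps `α → α` moving only finitely many points), as a
submonoid of all transformations of `α` under composition: `(σ * τ) i = σ (τ i)`. -/
def FinTrans (α : Type u) : Submonoid (Function.End α) where
  carrier := {τ | {i | τ i ≠ i}.Finite}
  one_mem' := by
    have h : {i : α | (1 : Function.End α) i ≠ i} = ∅ := by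
      ext i
      simp [Function.End.one_def]
    show Set.Finite {i : α | (1 : Function.End α) i ≠ i}
    rw [h]
    exact Set.finite_empty
  mul_mem' := by
    intro σ τ hσ hτ
    refine (hσ.union hτ).subset ?_
    intro i hi
    by_contra hcon
    simp only [Set.mem_union, Set.mem_ofPred_eq, not_or, not_not] at hcon
    apply hi
    show σ (τ i) = i
    rw [hcon.2, hcon.1]

/-- The underlying map of a finite transformation. -/
def finApp {α : Type u} (τ : FinTrans α) : α → α := τ.1

open Classical in
/-- The replacement `[k|l]`: it sends `k` to `l` and fixes every other point. -/
noncomputable def FinTrans.repl {α : Type u} (k l : α) : FinTrans α :=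
  ⟨(fun i => if i = k then l else i : α → α), by
    refine (Set.finite_singleton k).subset ?_
    intro i hi
    by_contra hik
    apply hi
    show (if i = k then l else i) = i
    exact if_neg hik⟩

/-- Algebras of the similarity type of polyadic Heyting algebras of dimension `α` over the finite
transformations, with carrier `A`: join, meet, implication, zero, substitutions `s τ`,
cylindrifiers `c J` and their duals `q J` for finite `J ⊆ α`. If `e = true` the type also has the
diagonal constants `d i j`; if `e = false` it has none. No laws are imposed here. -/
structure PolyAlg (e : Bool) (α : Type u) (A : Type v) where
  join : A → A → A
  meet : A → A → A
  imp : A → A → A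
  zero : A
  s : FinTrans α → A → A
  c : Finset α → A → A
  q : Finset α → A → A
  d : e = true → α → α → A

namespace PolyAlg

variable {e : Bool} {α : Type u} {A : Type v}

/-- The lattice order: `a ≤ b` iff `a ∧ b = a`. -/
def le (𝔄 : PolyAlg e α A) (a b : A) : Prop := 𝔄.meet a b = a

/-- The unit `1 = 0 → 0`. -/
def one (𝔄 : PolyAlg e α A) : A := 𝔄.imp 𝔄.zero 𝔄.zero

/-- `(A, ∨, ∧, →, 0)` is a Heyting algebra. -/
def IsHeyting (𝔄 : PolyAlg e α A) : Prop :=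
  ∃ _ : HeytingAlgebra A, (∀ a b : A, 𝔄.join a b = a ⊔ b) ∧ (∀ a b : A, 𝔄.meet a b = a ⊓ b) ∧
    (∀ a b : A, 𝔄.imp a b = a ⇨ b) ∧ 𝔄.zero = (⊥ : A)

/-- `f` is an endomorphism of `(A, ∨, ∧, →, 0)`. -/
structure IsHeytingEnd (𝔄 : PolyAlg e α A) (f : A → A) : Prop where
  join : ∀ p r, f (𝔄.join p r) = 𝔄.join (f p) (f r)
  meet : ∀ p r, f (𝔄.meet p r) = 𝔄.meet (f p) (f r)
  imp : ∀ p r, f (𝔄.imp p r) = 𝔄.imp (f p) (f r)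
  zero : f 𝔄.zero = 𝔄.zero

/-- `E` is an existential quantifier on the Heyting reduct. -/
structure IsExistential (𝔄 : PolyAlg e α A) (E : A → A) : Prop where
  zero : E 𝔄.zero = 𝔄.zero
  le : ∀ p, 𝔄.le p (E p)
  meet : ∀ p r, E (𝔄.meet p (E r)) = 𝔄.meet (E p) (E r)
  imp : ∀ p r, E (𝔄.imp (E p) (E r)) = 𝔄.imp (E p) (E r)
  join : ∀ p r, E (𝔄.join (E p) (E r)) = 𝔄.join (E p) (E r)
  idem : ∀ p, E (E p) = E p

/-- `U` is a universal quantifier on the Heyting reduct. -/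
structure IsUniversal (𝔄 : PolyAlg e α A) (U : A → A) : Prop where
  one : U 𝔄.one = 𝔄.one
  le : ∀ p, 𝔄.le (U p) p
  imp : ∀ p r, 𝔄.le (U (𝔄.imp p r)) (𝔄.imp (U p) (U r))
  idem : ∀ p, U (U p) = U p

open Classical in
/-- `𝔄` is a polyadic Heyting algebra of dimension `α` over the finite transformations
(`e = false`), respectively a polyadic Heyting algebra with equality (`e = true`).
In `c_s` and `q_s` the hypothesis says that `σ` is injective on `σ⁻¹(J)`, and
`J.preimage (finApp σ) h` is the finite set `σ⁻¹(J)`. -/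
structure IsGPHA (𝔄 : PolyAlg e α A) : Prop where
  heyting : 𝔄.IsHeyting
  s_end : ∀ τ, 𝔄.IsHeytingEnd (𝔄.s τ)
  c_ex : ∀ J, 𝔄.IsExistential (𝔄.c J)
  q_univ : ∀ J, 𝔄.IsUniversal (𝔄.q J)
  s_one : ∀ p, 𝔄.s 1 p = p
  s_mul : ∀ σ τ p, 𝔄.s (σ * τ) p = 𝔄.s σ (𝔄.s τ p)
  c_union : ∀ J J' p, 𝔄.c (J ∪ J') p = 𝔄.c J (𝔄.c J' p)
  q_union : ∀ J J' p, 𝔄.q (J ∪ J') p = 𝔄.q J (𝔄.q J' p)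
  c_q : ∀ J p, 𝔄.c J (𝔄.q J p) = 𝔄.q J p
  q_c : ∀ J p, 𝔄.q J (𝔄.c J p) = 𝔄.c J p
  s_c : ∀ (σ τ : FinTrans α) (J : Finset α) (p : A), (∀ i, i ∉ J → finApp σ i = finApp τ i) →
    𝔄.s σ (𝔄.c J p) = 𝔄.s τ (𝔄.c J p)
  s_q : ∀ (σ τ : FinTrans α) (J : Finset α) (p : A), (∀ i, i ∉ J → finApp σ i = finApp τ i) →
    𝔄.s σ (𝔄.q J p) = 𝔄.s τ (𝔄.q J p)
  c_s : ∀ (σ : FinTrans α) (J : Finset α) (p : A)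
      (h : Set.InjOn (finApp σ) (finApp σ ⁻¹' (J : Set α))),
    𝔄.c J (𝔄.s σ p) = 𝔄.s σ (𝔄.c (J.preimage (finApp σ) h) p)
  q_s : ∀ (σ : FinTrans α) (J : Finset α) (p : A)
      (h : Set.InjOn (finApp σ) (finApp σ ⁻¹' (J : Set α))),
    𝔄.q J (𝔄.s σ p) = 𝔄.s σ (𝔄.q (J.preimage (finApp σ) h) p)
  d_refl : ∀ (he : e = true) (k : α), 𝔄.d he k k = 𝔄.one
  s_d : ∀ (he : e = true) (τ : FinTrans α) (k l : α),
    𝔄.s τ (𝔄.d he k l) = 𝔄.d he (finApp τ k) (finApp τ l)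
  d_le : ∀ (he : e = true) (k l : α) (p : A),
    𝔄.le (𝔄.meet p (𝔄.d he k l)) (𝔄.s (FinTrans.repl k l) p)

/-- `𝔄.Sg X` is the subalgebra generated by `X` (its universe): the smallest subset that
contains `X` and is closed under all operations of `𝔄`, constants included. -/
inductive Sg (𝔄 : PolyAlg e α A) (X : Set A) : Set A
  | of (x : A) : x ∈ X → Sg 𝔄 X x
  | join (a b : A) : Sg 𝔄 X a → Sg 𝔄 X b → Sg 𝔄 X (𝔄.join a b)
  | meet (a b : A) : Sg 𝔄 X a → Sg 𝔄 X b → Sg 𝔄 X (𝔄.meet a b)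
  | imp (a b : A) : Sg 𝔄 X a → Sg 𝔄 X b → Sg 𝔄 X (𝔄.imp a b)
  | zero : Sg 𝔄 X 𝔄.zero
  | s (τ : FinTrans α) (a : A) : Sg 𝔄 X a → Sg 𝔄 X (𝔄.s τ a)
  | c (J : Finset α) (a : A) : Sg 𝔄 X a → Sg 𝔄 X (𝔄.c J a)
  | q (J : Finset α) (a : A) : Sg 𝔄 X a → Sg 𝔄 X (𝔄.q J a)
  | d (he : e = true) (i j : α) : Sg 𝔄 X (𝔄.d he i j)

/-- `R` is a congruence relation of `𝔄`. -/
structure IsCon (𝔄 : PolyAlg e α A) (R : Setoid A) : Prop where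
  join : ∀ a a' b b', R a a' → R b b' → R (𝔄.join a b) (𝔄.join a' b')
  meet : ∀ a a' b b', R a a' → R b b' → R (𝔄.meet a b) (𝔄.meet a' b')
  imp : ∀ a a' b b', R a a' → R b b' → R (𝔄.imp a b) (𝔄.imp a' b')
  s : ∀ τ a a', R a a' → R (𝔄.s τ a) (𝔄.s τ a')
  c : ∀ J a a', R a a' → R (𝔄.c J a) (𝔄.c J a')
  q : ∀ J a a', R a a' → R (𝔄.q J a) (𝔄.q J a')

/-- The quotient algebra `𝔄 / R`. -/
def quot (𝔄 : PolyAlg e α A) (R : Setoid A) (h : 𝔄.IsCon R) : PolyAlg e α (Quotient R) where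
  join := Quotient.map₂ 𝔄.join (fun _ _ ha _ _ hb => h.join _ _ _ _ ha hb)
  meet := Quotient.map₂ 𝔄.meet (fun _ _ ha _ _ hb => h.meet _ _ _ _ ha hb)
  imp := Quotient.map₂ 𝔄.imp (fun _ _ ha _ _ hb => h.imp _ _ _ _ ha hb)
  zero := Quotient.mk R 𝔄.zero
  s τ := Quotient.map (𝔄.s τ) (fun _ _ ha => h.s τ _ _ ha)
  c J := Quotient.map (𝔄.c J) (fun _ _ ha => h.c J _ _ ha)
  q J := Quotient.map (𝔄.q J) (fun _ _ ha => h.q J _ _ ha)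
  d he i j := Quotient.mk R (𝔄.d he i j)

end PolyAlg

/-- Words of the similarity type over the set of variables `δ`. -/
inductive PolyWord (e : Bool) (α : Type u) (δ : Type v) : Type (max u v)
  | var (η : δ) : PolyWord e α δ
  | join (a b : PolyWord e α δ) : PolyWord e α δ
  | meet (a b : PolyWord e α δ) : PolyWord e α δ
  | imp (a b : PolyWord e α δ) : PolyWord e α δ
  | zero : PolyWord e α δ
  | s (τ : FinTrans α) (a : PolyWord e α δ) : PolyWord e α δ
  | c (J : Finset α) (a : PolyWord e α δ) : PolyWord e α δ
  | q (J : Finset α) (a : PolyWord e α δ) : PolyWord e α δ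
  | d (he : e = true) (i j : α) : PolyWord e α δ

/-- The absolutely free algebra on `δ` generators. -/
def absFree (e : Bool) (α : Type u) (δ : Type v) : PolyAlg e α (PolyWord e α δ) where
  join := .join
  meet := .meet
  imp := .imp
  zero := .zero
  s := .s
  c := .c
  q := .q
  d := .d

section DimensionRestrictedFree

variable (e : Bool) {α : Type u} {δ : Type v} (ρ : δ → Set α)

/-- The congruences `R` of the absolutely free algebra such that the quotient by `R` is a polyadic
Heyting algebra (with equality if `e = true`) and `c_k η / R = η / R` for every generator `η` and
every `k ∉ ρ η`. The class of polyadic Heyting algebras is equational, hence closed under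
subalgebras and direct products, so asking for the quotient to be in `SP` of it is the same. -/
def IsRestrictedCon (R : Setoid (PolyWord e α δ)) : Prop :=
  ∃ h : (absFree e α δ).IsCon R, ((absFree e α δ).quot R h).IsGPHA ∧
    ∀ (η : δ) (k : α), k ∉ ρ η → R (PolyWord.c {k} (PolyWord.var η)) (PolyWord.var η)

/-- The intersection of all congruences as in `IsRestrictedCon`. -/
def restrictedCr : Setoid (PolyWord e α δ) := sInf {R | IsRestrictedCon e ρ R}

theorem restrictedCr_isCon : (absFree e α δ).IsCon (restrictedCr e ρ) where
  join a a' b b' ha hb := fun R hR => by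
    obtain ⟨h, _⟩ := id hR
    exact h.join _ _ _ _ (ha R hR) (hb R hR)
  meet a a' b b' ha hb := fun R hR => by
    obtain ⟨h, _⟩ := id hR
    exact h.meet _ _ _ _ (ha R hR) (hb R hR)
  imp a a' b b' ha hb := fun R hR => by
    obtain ⟨h, _⟩ := id hR
    exact h.imp _ _ _ _ (ha R hR) (hb R hR)
  s τ a a' ha := fun R hR => by
    obtain ⟨h, _⟩ := id hR
    exact h.s _ _ _ (ha R hR)
  c J a a' ha := fun R hR => by
    obtain ⟨h, _⟩ := id hR
    exact h.c _ _ _ (ha R hR)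
  q J a a' ha := fun R hR => by
    obtain ⟨h, _⟩ := id hR
    exact h.q _ _ _ (ha R hR)

/-- The carrier of the dimension-restricted free algebra with generators indexed by `δ` and
dimension restricting function `ρ`. -/
def DimFree : Type (max u v) := Quotient (restrictedCr e ρ)

/-- The dimension-restricted free algebra: without equality if `e = false`, with equality if
`e = true`. -/
def dimFree : PolyAlg e α (DimFree e ρ) :=
  (absFree e α δ).quot (restrictedCr e ρ) (restrictedCr_isCon e ρ)

/-- The free generators of the dimension-restricted free algebra. -/
def DimFree.gen (η : δ) : DimFree e ρ := Quotient.mk (restrictedCr e ρ) (PolyWord.var η)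

end DimensionRestrictedFree

/-! The proof is semantic: it builds a model in which a failure of interpolation would be visible.
Let `S` be the subalgebra generated by the common generators. A pair `x : Bool → H` of elements of
the free algebra is read as a left and a right assumption, and it forces `a` on side `b` when some
`i ∈ S` follows from the assumption of the other side and, with the assumption of side `b`, implies
`a`. These forcing sets are lower sets, and the smallest sublocale containing them is a frame
receiving two embeddings of `H`. Both are Heyting homomorphisms, they agree on `S`
(`interpEmb_eq_of_mem`), and an inequality between opposite sides yields an interpolant
(`exists_interpolant_of_interpEmb_le`).

Quantifiers become suprema and infima over substitutions. Since every finite set of elements is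
independent of infinitely many coordinates, a quantified coordinate can be renamed to a fresh one,
and quantifying over it leaves the finitely many side elements fixed
(`IsGPHA.exists_fresh_quantifier`, `interpEmb_le_iSup`, `iInf_le_interpEmb`).

Freeness is then used once. Functions from finite transformations to the frame carry the polyadic
operations. Generators in `X₁` are interpreted through the first embedding and all others through
the second; this is a legitimate assignment, so the kernel of evaluation is one of the congruences
defining the free algebra (`isRestrictedCon_ker_eval`). Words for `θ₁` evaluate along the first
embedding, words for `θ₂` along the second, because the embeddings coincide on common generators
(`exists_word_of_mem_sg`). Hence `θ₁ ≤ θ₂` passes to an inequality between opposite sides at the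
identity transformation. -/

/-! ### Amalgamating two copies of a Heyting algebra over a subalgebra. -/

section InterpolationFrame

/-- A pair of mutually adjoint quantifiers on a Heyting algebra: `c` and `q` are the best
approximations from above and from below by the fixed points of `c`. -/
structure IsQuantifierPair {H : Type*} [HeytingAlgebra H] (c q : H → H) : Prop where
  le_c : ∀ a, a ≤ c a
  c_le : ∀ a t, c t = t → a ≤ t → c a ≤ t
  c_c : ∀ a, c (c a) = c a
  q_le : ∀ a, q a ≤ a
  le_q : ∀ a t, c t = t → t ≤ a → t ≤ q a
  c_q : ∀ a, c (q a) = q a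
  inf : ∀ a b, c a = a → c b = b → c (a ⊓ b) = a ⊓ b
  himp : ∀ a b, c a = a → c b = b → c (a ⇨ b) = a ⇨ b

/-- A subset of a Heyting algebra closed under the Heyting operations. -/
structure IsHeytingSub {H : Type*} [HeytingAlgebra H] (S : Set H) : Prop where
  sup : ∀ a ∈ S, ∀ b ∈ S, a ⊔ b ∈ S
  inf : ∀ a ∈ S, ∀ b ∈ S, a ⊓ b ∈ S
  himp : ∀ a ∈ S, ∀ b ∈ S, a ⇨ b ∈ S
  bot : ⊥ ∈ S

theorem IsHeytingSub.top {H : Type*} [HeytingAlgebra H] {S : Set H} (hS : IsHeytingSub S) :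
    ⊤ ∈ S := by
  simpa using hS.himp ⊥ hS.bot ⊥ hS.bot

/-- The sublocale generated by a family of elements of a frame. -/
def sublocaleGenerate {L : Type*} [Order.Frame L] (𝒦 : Set L) : Sublocale L where
  -- The condition says that `U` is recovered as the infimum of all `(U ⇨ K) ⇨ K`. An inequality `Z
  -- ≤ U` therefore only has to be tested against the generators.
  carrier := {U | ∀ Z, (∀ K ∈ 𝒦, Z ⊓ (U ⇨ K) ≤ K) → Z ≤ U}
  sInf_mem' s hs Z hZ := le_sInf fun U hU => hs hU Z fun K hK =>
    (inf_le_inf_left Z (himp_le_himp_right (sInf_le hU))).trans (hZ K hK)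
  himp_mem' a b hb Z hZ := by
    rw [le_himp_iff]
    refine hb _ fun K hK => le_trans ?_ (hZ K hK)
    rw [inf_assoc]
    refine inf_le_inf_left Z ?_
    rw [le_himp_iff]
    calc a ⊓ (b ⇨ K) ⊓ (a ⇨ b) = (b ⇨ K) ⊓ (a ⊓ (a ⇨ b)) := by ac_rfl
      _ ≤ (b ⇨ K) ⊓ b := inf_le_inf_left _ inf_himp_le
      _ ≤ K := himp_inf_le

theorem mem_sublocaleGenerate {L : Type*} [Order.Frame L] {𝒦 : Set L} {K : L} (hK : K ∈ 𝒦) :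
    K ∈ sublocaleGenerate 𝒦 := fun Z hZ => by simpa using hZ K hK

theorem le_of_mem_sublocaleGenerate {L : Type*} [Order.Frame L] {𝒦 : Set L} {U Z : L}
    (hU : U ∈ sublocaleGenerate 𝒦) (hZ : ∀ K ∈ 𝒦, Z ⊓ (U ⇨ K) ≤ K) : Z ≤ U := hU Z hZ

variable {H : Type*} [HeytingAlgebra H] (S : Set H)

/-- The pairs `x` of elements, seen as sequents with a left and a right part, that entail the
element `a` of side `b` through an interpolant in `S`. -/
def interpLower (b : Bool) (a : H) : LowerSet (Bool → H) where
  carrier := {x | ∃ i ∈ S, x (!b) ≤ i ∧ x b ⊓ i ≤ a}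
  lower' := by
    rintro x y hyx ⟨i, hi, h₁, h₂⟩
    exact ⟨i, hi, (hyx _).trans h₁, (inf_le_inf_right i (hyx b)).trans h₂⟩

/-- The locale in which two copies of `H` are amalgamated over `S`. -/
def interpLocale : Sublocale (LowerSet (Bool → H)) :=
  sublocaleGenerate (Set.range fun p : Bool × H => interpLower S p.1 p.2)

/-- The two embeddings of `H` into the amalgam over `S`. -/
def interpEmb (b : Bool) (a : H) : interpLocale S :=
  ⟨interpLower S b a, mem_sublocaleGenerate ⟨(b, a), rfl⟩⟩

variable {S}

theorem update_inf_le (x : Bool → H) (b : Bool) (a : H) :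
    Function.update x b (x b ⊓ a) ≤ x :=
  update_le_iff.2 ⟨inf_le_left, fun _ _ => le_rfl⟩

theorem update_mem_interpLower (hS : IsHeytingSub S) (b : Bool) (a : H) (x : Bool → H) :
    Function.update x b (x b ⊓ a) ∈ interpLower S b a :=
  ⟨⊤, hS.top, le_top, by simp⟩

/-- An embedded element `e` lies below `U` as soon as every sequent of `e` that entails `t` after
adding any element below `U` already entails `t`, for `t` on either side. -/
theorem interpEmb_le_of_forall (hS : IsHeytingSub S) {b : Bool} {e : H} {U : interpLocale S}
    (h : ∀ x y, ∀ i ∈ S, y ≤ i → x ⊓ i ≤ e → ∀ t,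
      ((∀ a, interpEmb S b a ≤ U → ∃ j ∈ S, y ≤ j ∧ a ≤ x ⊓ j ⇨ t) →
        ∃ j ∈ S, y ≤ j ∧ x ⊓ j ≤ t) ∧
      ((∀ a, interpEmb S b a ≤ U → ∃ j ∈ S, a ≤ x ⇨ j ∧ j ≤ y ⇨ t) →
        ∃ j ∈ S, x ≤ j ∧ y ⊓ j ≤ t)) : interpEmb S b e ≤ U := by
  refine le_of_mem_sublocaleGenerate (𝒦 := Set.range fun p : Bool × H => interpLower S p.1 p.2)
    U.2 ?_
  rintro _ ⟨⟨b', t⟩, rfl⟩ x ⟨⟨i, hi, h₁, h₂⟩, hxU⟩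
  have key : ∀ a, interpEmb S b a ≤ U →
      Function.update x b (x b ⊓ a) ∈ interpLower S b' t := fun a ha => by
    have h1 : Function.update x b (x b ⊓ a) ∈ (U.1 ⇨ interpLower S b' t) :=
      LowerSet.lower _ (update_inf_le x b a) hxU
    exact (himp_inf_le : (U.1 ⇨ interpLower S b' t) ⊓ U.1 ≤ _)
      ⟨h1, ha (update_mem_interpLower hS b a x)⟩
  obtain ⟨hl, hr⟩ := h (x b) (x !b) i hi h₁ h₂ t
  rcases Bool.eq_or_eq_not b' b with rfl | rfl
  · refine hl fun a ha => ?_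
    obtain ⟨j, hj, h₃, h₄⟩ := key a ha
    refine ⟨j, hj, by simpa using h₃, ?_⟩
    rw [Function.update_self] at h₄
    rwa [le_himp_iff, ← inf_assoc, inf_comm a]
  · obtain ⟨j, hj, h₃, h₄⟩ := hr fun a ha => by
      obtain ⟨j, hj, h₃, h₄⟩ := key a ha
      rw [Bool.not_not, Function.update_self] at h₃
      rw [Function.update_of_ne (by simp)] at h₄
      exact ⟨j, hj, by rwa [le_himp_iff, inf_comm], by rwa [le_himp_iff, inf_comm]⟩
    exact ⟨j, hj, by simpa using h₃, h₄⟩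

theorem interpEmb_mono (b : Bool) {a a' : H} (h : a ≤ a') :
    interpEmb S b a ≤ interpEmb S b a' := by
  rintro x ⟨i, hi, h₁, h₂⟩
  exact ⟨i, hi, h₁, h₂.trans h⟩

theorem interpEmb_top (hS : IsHeytingSub S) (b : Bool) : interpEmb S b ⊤ = ⊤ :=
  top_le_iff.1 fun _ _ => ⟨⊤, hS.top, le_top, le_top⟩

theorem interpEmb_inf (hS : IsHeytingSub S) (b : Bool) (a a' : H) :
    interpEmb S b (a ⊓ a') = interpEmb S b a ⊓ interpEmb S b a' := by
  refine le_antisymm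
    (le_inf (interpEmb_mono b inf_le_left) (interpEmb_mono b inf_le_right)) ?_
  rintro x ⟨⟨i, hi, h₁, h₂⟩, ⟨j, hj, h₃, h₄⟩⟩
  refine ⟨i ⊓ j, hS.inf i hi j hj, le_inf h₁ h₃, le_inf (le_trans ?_ h₂) (le_trans ?_ h₄)⟩
  · exact inf_le_inf_left _ inf_le_left
  · exact inf_le_inf_left _ inf_le_right

/-- A pair forcing the implication is strengthened by the assumption `a` on side `b`. It then forces
`a'`, and `a` is discharged by the adjunction without changing the interpolant. -/
theorem interpEmb_himp (hS : IsHeytingSub S) (b : Bool) (a a' : H) :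
    interpEmb S b (a ⇨ a') = interpEmb S b a ⇨ interpEmb S b a' := by
  refine le_antisymm ?_ ?_
  · rw [le_himp_iff, ← interpEmb_inf hS]
    exact interpEmb_mono b himp_inf_le
  · intro x hx
    have h1 : Function.update x b (x b ⊓ a) ∈ (interpLower S b a ⇨ interpLower S b a') :=
      LowerSet.lower _ (update_inf_le x b a) hx
    obtain ⟨i, hi, h₁, h₂⟩ :=
      (himp_inf_le : (interpLower S b a ⇨ interpLower S b a') ⊓ interpLower S b a ≤ _)
        ⟨h1, update_mem_interpLower hS b a x⟩
    refine ⟨i, hi, by simpa using h₁, ?_⟩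
    rw [le_himp_iff]
    rw [Function.update_self, inf_right_comm] at h₂
    exact h₂

theorem interpEmb_bot (hS : IsHeytingSub S) (b : Bool) : interpEmb S b ⊥ = ⊥ := by
  refine le_bot_iff.1 (interpEmb_le_of_forall hS fun x y i hi hy hx t => ⟨fun _ => ?_, fun _ => ?_⟩)
  · exact ⟨i, hi, hy, hx.trans bot_le⟩
  · refine ⟨i ⇨ ⊥, hS.himp i hi ⊥ hS.bot, le_himp_iff.2 hx, ?_⟩
    exact (inf_le_inf_right _ hy).trans (inf_himp_le.trans bot_le)

/-- Joins in the sublocale are larger than unions of lower sets, so the inequality is tested against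
the generators. The two cases combine interpolants as in the disjunction rule of a sequent calculus.
-/
theorem interpEmb_sup (hS : IsHeytingSub S) (b : Bool) (a a' : H) :
    interpEmb S b (a ⊔ a') = interpEmb S b a ⊔ interpEmb S b a' := by
  refine le_antisymm
    (interpEmb_le_of_forall hS fun x y i hi hy hx t => ⟨fun h => ?_, fun h => ?_⟩)
    (sup_le (interpEmb_mono b le_sup_left) (interpEmb_mono b le_sup_right))
  · obtain ⟨j, hj, h₃, h₄⟩ := h a le_sup_left
    obtain ⟨k, hk, h₅, h₆⟩ := h a' le_sup_right
    have hl : i ⊓ (j ⊓ k) ≤ j := inf_le_right.trans inf_le_left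
    have hr : i ⊓ (j ⊓ k) ≤ k := inf_le_right.trans inf_le_right
    refine ⟨i ⊓ (j ⊓ k), hS.inf i hi _ (hS.inf j hj k hk), le_inf hy (le_inf h₃ h₅), ?_⟩
    have : x ⊓ (i ⊓ (j ⊓ k)) ≤ x ⊓ (i ⊓ (j ⊓ k)) ⇨ t :=
      ((inf_le_inf_left x inf_le_left).trans hx).trans <| sup_le
        (h₄.trans (himp_le_himp_right (inf_le_inf_left x hl)))
        (h₆.trans (himp_le_himp_right (inf_le_inf_left x hr)))
    rwa [le_himp_iff, inf_idem] at this
  · obtain ⟨j, hj, h₃, h₄⟩ := h a le_sup_left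
    obtain ⟨k, hk, h₅, h₆⟩ := h a' le_sup_right
    -- The goal `t` is on the side opposite to the disjunction, so the roles in the interpolant are
    -- exchanged: `i` is now an assumption supplied by `y`.
    refine ⟨i ⇨ j ⊔ k, hS.himp i hi _ (hS.sup j hj k hk), ?_, ?_⟩
    · have : x ⊓ i ≤ x ⊓ i ⇨ j ⊔ k := hx.trans <| sup_le
        (h₃.trans (himp_le_himp inf_le_left le_sup_left))
        (h₅.trans (himp_le_himp inf_le_left le_sup_right))
      rwa [le_himp_iff, inf_idem, ← le_himp_iff] at this
    · have : y ⊓ (i ⇨ j ⊔ k) ≤ y ⊓ (j ⊔ k) :=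
        le_inf inf_le_left ((inf_le_inf_right _ hy).trans inf_himp_le)
      refine this.trans ?_
      rw [inf_comm, ← le_himp_iff]
      exact sup_le h₄ h₆

/-- If `i` is an interpolant for one direction, then `i ⇨ a`, again in `S`, is one for the opposite
direction. -/
theorem interpEmb_eq_of_mem (hS : IsHeytingSub S) {a : H} (ha : a ∈ S) (b b' : Bool) :
    interpEmb S b a = interpEmb S b' a := by
  have key : ∀ b, interpEmb S b a ≤ interpEmb S (!b) a := by
    rintro b x ⟨i, hi, h₁, h₂⟩
    refine ⟨i ⇨ a, hS.himp i hi a ha, ?_, (inf_le_inf_right _ h₁).trans inf_himp_le⟩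
    rw [Bool.not_not, le_himp_iff]
    exact h₂
  rcases Bool.eq_or_eq_not b' b with rfl | rfl
  · rfl
  · exact le_antisymm (key b) (by simpa using key (!b))

theorem exists_interpolant_of_interpEmb_le (hS : IsHeytingSub S) {b : Bool} {a a' : H}
    (h : interpEmb S b a ≤ interpEmb S (!b) a') : ∃ i ∈ S, a ≤ i ∧ i ≤ a' := by
  -- The test pair assumes `a` on its own side and nothing on the other.
  have hx : (Function.update (fun _ => ⊤) b a : Bool → H) ∈ interpLower S b a :=
    ⟨⊤, hS.top, le_top, by simp⟩
  obtain ⟨i, hi, h₁, h₂⟩ := h hx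
  exact ⟨i, hi, by simpa using h₁, by simpa using h₂⟩

/-- If finitely many elements can be kept fixed by quantifiers that send some `a n` above `e`,
then `e` is embedded below the supremum of the family `a`. -/
theorem interpEmb_le_iSup (hS : IsHeytingSub S) {ι : Sort*} (b : Bool) (e : H) (a : ι → H)
    (h : ∀ x y t : H, ∃ (n : ι) (c q : H → H), IsQuantifierPair c q ∧ (∀ i ∈ S, c i ∈ S) ∧
      (∀ i ∈ S, q i ∈ S) ∧ c x = x ∧ c y = y ∧ c t = t ∧ e ≤ c (a n)) :
    interpEmb S b e ≤ ⨆ n, interpEmb S b (a n) := by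
  refine interpEmb_le_of_forall hS fun x y i hi hy hx t => ?_
  obtain ⟨n, c, q, hQ, hc, hq, cx, cy, ct, hn⟩ := h x y t
  have hle := le_iSup (fun n => interpEmb S b (a n)) n
  refine ⟨fun h => ?_, fun h => ?_⟩
  · obtain ⟨j, hj, h₃, h₄⟩ := h _ hle
    -- Passing from `j` to `q j` keeps it above the fixed `y` and makes `x ⊓ q j ⇨ t` fixed. A bound
    -- on `a n` then bounds `c (a n)`, hence `e`.
    refine ⟨i ⊓ q j, hS.inf i hi _ (hq j hj), le_inf hy (hQ.le_q _ _ cy h₃), ?_⟩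
    have h₅ : e ≤ x ⊓ q j ⇨ t := hn.trans <|
      hQ.c_le _ _ (hQ.himp _ _ (hQ.inf _ _ cx (hQ.c_q j)) ct)
        (h₄.trans (himp_le_himp_right (inf_le_inf_left x (hQ.q_le j))))
    have : x ⊓ (i ⊓ q j) ≤ x ⊓ (i ⊓ q j) ⇨ t :=
      ((inf_le_inf_left x inf_le_left).trans hx).trans
        (h₅.trans (himp_le_himp_right (inf_le_inf_left x inf_le_right)))
    rwa [le_himp_iff, inf_idem] at this
  · obtain ⟨j, hj, h₃, h₄⟩ := h _ hle
    -- On the opposite side `j` is a conclusion of `x` and an assumption for `t`, so it is weakened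
    -- to the fixed element `c j`.
    refine ⟨i ⇨ c j, hS.himp i hi _ (hc j hj), ?_, ?_⟩
    · have h₅ : e ≤ x ⇨ c j := hn.trans <|
        hQ.c_le _ _ (hQ.himp _ _ cx (hQ.c_c j)) (h₃.trans (himp_le_himp_left (hQ.le_c j)))
      have : x ⊓ i ≤ x ⊓ i ⇨ c j := hx.trans (h₅.trans (himp_le_himp_right inf_le_left))
      rwa [le_himp_iff, inf_idem, ← le_himp_iff] at this
    · have : y ⊓ (i ⇨ c j) ≤ y ⊓ c j :=
        le_inf inf_le_left ((inf_le_inf_right _ hy).trans inf_himp_le)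
      refine this.trans ?_
      rw [inf_comm, ← le_himp_iff]
      exact hQ.c_le _ _ (hQ.himp _ _ cy ct) h₄

/-- Infima in a sublocale are intersections, so no test against generators is needed: one member of
the family is taken at `x` and its interpolant is replaced by its `q`. -/
theorem iInf_le_interpEmb {ι : Sort*} (b : Bool) (e : H) (a : ι → H)
    (h : ∀ x y : H, ∃ (n : ι) (c q : H → H), IsQuantifierPair c q ∧
      (∀ i ∈ S, q i ∈ S) ∧ c x = x ∧ c y = y ∧ q (a n) ≤ e) :
    ⨅ n, interpEmb S b (a n) ≤ interpEmb S b e := by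
  intro x hx
  obtain ⟨n, c, q, hQ, hq, cx, cy, hn⟩ := h (x b) (x !b)
  obtain ⟨i, hi, h₁, h₂⟩ := (iInf_le (fun n => interpEmb S b (a n)) n) hx
  refine ⟨q i, hq i hi, hQ.le_q _ _ cy h₁, le_trans ?_ hn⟩
  exact hQ.le_q _ _ (hQ.inf _ _ cx (hQ.c_q i)) ((inf_le_inf_left _ (hQ.q_le i)).trans h₂)

end InterpolationFrame

/-! ### Finite transformations and agreement off a finite set. -/

section FiniteTransformations

variable {α : Type u}

@[simp] theorem finApp_mul (σ τ : FinTrans α) (i : α) :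
    finApp (σ * τ) i = finApp σ (finApp τ i) := rfl

theorem finApp_ext {σ τ : FinTrans α} (h : ∀ i, finApp σ i = finApp τ i) : σ = τ :=
  Subtype.ext (funext h)

open Classical in
theorem finApp_repl (k l i : α) : finApp (FinTrans.repl k l) i = if i = k then l else i := rfl

/-- The transformation `σ`, changed to `f` on the finite set `J`. -/
noncomputable def modifyOn (σ : FinTrans α) (J : Finset α) (f : α → α) : FinTrans α := by
  classical
  exact ⟨(fun i => if i ∈ J then f i else finApp σ i : α → α), by
    refine (J.finite_toSet.union σ.2).subset ?_
    intro i hi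
    by_contra hcon
    simp only [Set.mem_union, Finset.mem_coe, Set.mem_ofPred_eq, not_or, not_not] at hcon
    apply hi
    show (if i ∈ J then f i else finApp σ i) = i
    rw [if_neg hcon.1]
    exact hcon.2⟩

theorem modifyOn_of_mem (σ : FinTrans α) {J : Finset α} (f : α → α) {i : α} (hi : i ∈ J) :
    finApp (modifyOn σ J f) i = f i := if_pos hi

theorem modifyOn_of_notMem (σ : FinTrans α) {J : Finset α} (f : α → α) {i : α}
    (hi : i ∉ J) : finApp (modifyOn σ J f) i = finApp σ i := if_neg hi

/-- `σ` and `τ` agree outside `J`. -/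
def AgreeOff (J : Finset α) (σ τ : FinTrans α) : Prop := ∀ i, i ∉ J → finApp σ i = finApp τ i

theorem AgreeOff.refl (J : Finset α) (σ : FinTrans α) : AgreeOff J σ σ := fun _ _ => rfl

theorem AgreeOff.symm {J : Finset α} {σ τ : FinTrans α} (h : AgreeOff J σ τ) : AgreeOff J τ σ :=
  fun i hi => (h i hi).symm

theorem AgreeOff.trans {J : Finset α} {σ τ μ : FinTrans α} (h : AgreeOff J σ τ)
    (h' : AgreeOff J τ μ) : AgreeOff J σ μ := fun i hi => (h i hi).trans (h' i hi)

theorem agreeOff_modifyOn (σ : FinTrans α) (J : Finset α) (f : α → α) :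
    AgreeOff J (modifyOn σ J f) σ := fun _ hi => modifyOn_of_notMem σ f hi

theorem AgreeOff.congr_right {J : Finset α} {σ τ : FinTrans α} (h : AgreeOff J σ τ)
    (ν : FinTrans α) : AgreeOff J ν σ ↔ AgreeOff J ν τ :=
  ⟨fun h' => h'.trans h, fun h' => h'.trans h.symm⟩

theorem AgreeOff.mul_left {J : Finset α} {σ τ : FinTrans α} (h : AgreeOff J σ τ)
    (μ : FinTrans α) : AgreeOff J (μ * σ) (μ * τ) := fun i hi => by
  rw [finApp_mul, finApp_mul, h i hi]

open Classical in
theorem exists_agreeOff_union {J J' : Finset α} {ν σ : FinTrans α} :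
    AgreeOff (J ∪ J') ν σ ↔ ∃ μ, AgreeOff J μ σ ∧ AgreeOff J' ν μ := by
  constructor
  · intro h
    refine ⟨modifyOn σ J (finApp ν), agreeOff_modifyOn _ _ _, fun i hi => ?_⟩
    by_cases hJ : i ∈ J
    · rw [modifyOn_of_mem σ _ hJ]
    · rw [modifyOn_of_notMem σ _ hJ]
      exact h i (by simp [hJ, hi])
  · rintro ⟨μ, h, h'⟩ i hi
    rw [Finset.mem_union, not_or] at hi
    exact (h' i hi.2).trans (h i hi.1)

/-- This is the combinatorial content of the law commuting quantifiers with substitutions.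
Injectivity of `σ` over `J` allows the values of `κ` on `J` to be read off from `ν`. -/
theorem exists_agreeOff_preimage {J : Finset α} {σ μ ν : FinTrans α}
    (h : Set.InjOn (finApp σ) (finApp σ ⁻¹' (J : Set α))) :
    AgreeOff (J.preimage (finApp σ) h) ν (μ * σ) ↔ ∃ κ, AgreeOff J κ μ ∧ κ * σ = ν := by
  classical
  constructor
  · intro hν
    -- Points outside the range of `σ` do not influence `κ * σ`; their value is arbitrary.
    let f : α → α := fun j => if hj : ∃ i, finApp σ i = j then finApp ν hj.choose else j
    refine ⟨modifyOn μ J f, agreeOff_modifyOn _ _ _, finApp_ext fun i => ?_⟩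
    rw [finApp_mul]
    by_cases hi : finApp σ i ∈ J
    · rw [modifyOn_of_mem μ _ hi]
      have hj : ∃ i', finApp σ i' = finApp σ i := ⟨i, rfl⟩
      have : hj.choose = i := h (by simpa [hj.choose_spec] using hi) (by simpa using hi)
        hj.choose_spec
      show (if hj : ∃ i', finApp σ i' = finApp σ i then finApp ν hj.choose else _) = _
      rw [dif_pos hj, this]
    · rw [modifyOn_of_notMem μ _ hi]
      exact (hν i (by simpa using hi)).symm
  · rintro ⟨κ, hκ, rfl⟩ i hi
    exact hκ _ fun hJ => hi (Finset.mem_preimage.2 hJ)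

end FiniteTransformations

/-! ### Algebras of frame-valued functions satisfy the polyadic laws. -/

namespace PolyAlg

variable {e : Bool} {α : Type u} {A : Type v}

theorem isHeyting_of_injective {B : Type*} [HeytingAlgebra B] (𝔄 : PolyAlg e α A) (φ : A → B)
    (hφ : Function.Injective φ) (hj : ∀ a b, φ (𝔄.join a b) = φ a ⊔ φ b)
    (hm : ∀ a b, φ (𝔄.meet a b) = φ a ⊓ φ b) (hi : ∀ a b, φ (𝔄.imp a b) = φ a ⇨ φ b)
    (hz : φ 𝔄.zero = ⊥) : 𝔄.IsHeyting := by
  let _ : Max A := ⟨𝔄.join⟩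
  let _ : Min A := ⟨𝔄.meet⟩
  let _ : LE A := ⟨fun a b => φ a ≤ φ b⟩
  let _ : LT A := ⟨fun a b => φ a < φ b⟩
  let _ : Top A := ⟨𝔄.imp 𝔄.zero 𝔄.zero⟩
  let _ : Bot A := ⟨𝔄.zero⟩
  let _ : Compl A := ⟨fun a => 𝔄.imp a 𝔄.zero⟩
  let _ : HImp A := ⟨𝔄.imp⟩
  refine ⟨hφ.heytingAlgebra φ Iff.rfl Iff.rfl hj hm ?_ hz ?_ hi, fun _ _ => rfl, fun _ _ => rfl,
    fun _ _ => rfl, rfl⟩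
  · exact (hi _ _).trans himp_self
  · intro a
    exact (hi _ _).trans (by rw [hz, himp_bot])

/-- `φ` represents `𝔄` faithfully by functions on the finite transformations with values in `C`,
on which substitutions act by translation, cylindrifiers are suprema and infima, and the diagonal
constants come from the `C`-valued equality `D`, respected by the represented functions. -/
structure IsFunctionalRep {C : Type*} [Order.Frame C] (𝔄 : PolyAlg e α A)
    (φ : A → FinTrans α → C) (D : e = true → α → α → C) : Prop where
  inj : Function.Injective φ
  join : ∀ a b σ, φ (𝔄.join a b) σ = φ a σ ⊔ φ b σ
  meet : ∀ a b σ, φ (𝔄.meet a b) σ = φ a σ ⊓ φ b σ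
  imp : ∀ a b σ, φ (𝔄.imp a b) σ = φ a σ ⇨ φ b σ
  zero : ∀ σ, φ 𝔄.zero σ = ⊥
  s : ∀ τ a σ, φ (𝔄.s τ a) σ = φ a (σ * τ)
  c : ∀ J a σ, φ (𝔄.c J a) σ = ⨆ (ν) (_ : AgreeOff J ν σ), φ a ν
  q : ∀ J a σ, φ (𝔄.q J a) σ = ⨅ (ν) (_ : AgreeOff J ν σ), φ a ν
  d : ∀ he k l σ, φ (𝔄.d he k l) σ = D he (finApp σ k) (finApp σ l)
  d_refl : ∀ he k, D he k k = ⊤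
  d_le : ∀ he k l a σ,
    φ a σ ⊓ D he (finApp σ k) (finApp σ l) ≤ φ a (σ * FinTrans.repl k l)

namespace IsFunctionalRep

variable {C : Type*} [Order.Frame C] {𝔄 : PolyAlg e α A} {φ : A → FinTrans α → C}
  {D : e = true → α → α → C}

theorem ext (h : 𝔄.IsFunctionalRep φ D) {a b : A} (hab : ∀ σ, φ a σ = φ b σ) : a = b :=
  h.inj (funext hab)

theorem le_iff (h : 𝔄.IsFunctionalRep φ D) {a b : A} : 𝔄.le a b ↔ ∀ σ, φ a σ ≤ φ b σ := by
  refine ⟨fun hab σ => ?_, fun hab => h.ext fun σ => ?_⟩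
  · rw [← inf_eq_left, ← h.meet]
    exact congrArg (φ · σ) hab
  · rw [h.meet]
    exact inf_eq_left.2 (hab σ)

theorem one (h : 𝔄.IsFunctionalRep φ D) (σ : FinTrans α) : φ 𝔄.one σ = ⊤ := by
  rw [PolyAlg.one, h.imp, himp_self]

theorem c_congr (h : 𝔄.IsFunctionalRep φ D) {J : Finset α} {σ τ : FinTrans α}
    (hστ : AgreeOff J σ τ) (a : A) : φ (𝔄.c J a) σ = φ (𝔄.c J a) τ := by
  rw [h.c, h.c]
  simp only [hστ.congr_right]

theorem q_congr (h : 𝔄.IsFunctionalRep φ D) {J : Finset α} {σ τ : FinTrans α}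
    (hστ : AgreeOff J σ τ) (a : A) : φ (𝔄.q J a) σ = φ (𝔄.q J a) τ := by
  rw [h.q, h.q]
  simp only [hστ.congr_right]

theorem le_c (h : 𝔄.IsFunctionalRep φ D) (J : Finset α) (a : A) (σ : FinTrans α) :
    φ a σ ≤ φ (𝔄.c J a) σ := by
  rw [h.c]
  exact le_iSup₂_of_le σ (AgreeOff.refl J σ) le_rfl

theorem q_le (h : 𝔄.IsFunctionalRep φ D) (J : Finset α) (a : A) (σ : FinTrans α) :
    φ (𝔄.q J a) σ ≤ φ a σ := by
  rw [h.q]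
  exact iInf₂_le_of_le σ (AgreeOff.refl J σ) le_rfl

/-- Functions that do not depend on the coordinates in `J` are fixed by `c J`. -/
theorem c_eq_of_congr (h : 𝔄.IsFunctionalRep φ D) {J : Finset α} {a : A}
    (ha : ∀ σ τ, AgreeOff J σ τ → φ a σ = φ a τ) : 𝔄.c J a = a := h.ext fun σ => by
  refine le_antisymm ?_ (h.le_c J a σ)
  rw [h.c]
  exact iSup₂_le fun ν hν => (ha ν σ hν).le

theorem q_eq_of_congr (h : 𝔄.IsFunctionalRep φ D) {J : Finset α} {a : A}
    (ha : ∀ σ τ, AgreeOff J σ τ → φ a σ = φ a τ) : 𝔄.q J a = a := h.ext fun σ => by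
  refine le_antisymm (h.q_le J a σ) ?_
  rw [h.q]
  exact le_iInf₂ fun ν hν => (ha ν σ hν).ge

/-- A quantified function is constant on classes of transformations agreeing off `J`, and such
functions are fixed by both quantifiers. Frame distributivity gives the meet law; the laws for
unions and preimages are reindexings. -/
theorem isGPHA (h : 𝔄.IsFunctionalRep φ D) : 𝔄.IsGPHA where
  heyting := by
    refine isHeyting_of_injective 𝔄 φ h.inj ?_ ?_ ?_ ?_
    · exact fun a b => funext (h.join a b)
    · exact fun a b => funext (h.meet a b)
    · exact fun a b => funext (h.imp a b)
    · exact funext h.zero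
  s_end τ :=
    { join := fun p r => h.ext fun σ => by simp only [h.s, h.join]
      meet := fun p r => h.ext fun σ => by simp only [h.s, h.meet]
      imp := fun p r => h.ext fun σ => by simp only [h.s, h.imp]
      zero := h.ext fun σ => by simp only [h.s, h.zero] }
  c_ex J :=
    { zero := h.ext fun σ => by simp only [h.c, h.zero, iSup_bot]
      le := fun p => h.le_iff.2 (h.le_c J p)
      meet := fun p r => h.ext fun σ => by
        rw [h.c, h.meet, h.c J p, iSup₂_inf_eq]
        refine iSup_congr fun ν => iSup_congr fun hν => ?_
        rw [h.meet, h.c_congr hν]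
      imp := fun p r => h.c_eq_of_congr fun σ τ hστ => by
        rw [h.imp, h.imp, h.c_congr hστ, h.c_congr hστ]
      join := fun p r => h.c_eq_of_congr fun σ τ hστ => by
        rw [h.join, h.join, h.c_congr hστ, h.c_congr hστ]
      idem := fun p => h.c_eq_of_congr fun σ τ hστ => h.c_congr hστ p }
  q_univ J :=
    { one := h.q_eq_of_congr fun σ τ _ => by rw [h.one, h.one]
      le := fun p => h.le_iff.2 (h.q_le J p)
      imp := fun p r => h.le_iff.2 fun σ => by
        rw [h.imp, le_himp_iff, h.q J r]
        refine le_iInf₂ fun ν hν => ?_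
        rw [← h.q_congr hν, ← h.q_congr hν, ← le_himp_iff]
        refine (h.q_le J _ ν).trans ?_
        rw [h.imp]
        exact himp_le_himp_right (h.q_le J p ν)
      idem := fun p => h.q_eq_of_congr fun σ τ hστ => h.q_congr hστ p }
  s_one p := h.ext fun σ => by rw [h.s, mul_one]
  s_mul σ τ p := h.ext fun μ => by rw [h.s, h.s, h.s, mul_assoc]
  c_union J J' p := h.ext fun σ => by
    simp only [h.c, exists_agreeOff_union, iSup_exists, iSup_and]
    rw [iSup_comm]
    refine iSup_congr fun μ => ?_
    rw [iSup_comm]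
  q_union J J' p := h.ext fun σ => by
    simp only [h.q, exists_agreeOff_union, iInf_exists, iInf_and]
    rw [iInf_comm]
    refine iInf_congr fun μ => ?_
    rw [iInf_comm]
  c_q J p := h.c_eq_of_congr fun σ τ hστ => h.q_congr hστ p
  q_c J p := h.q_eq_of_congr fun σ τ hστ => h.c_congr hστ p
  s_c σ τ J p hστ := h.ext fun μ => by
    rw [h.s, h.s]
    exact h.c_congr (AgreeOff.mul_left hστ μ) p
  s_q σ τ J p hστ := h.ext fun μ => by
    rw [h.s, h.s]
    exact h.q_congr (AgreeOff.mul_left hστ μ) p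
  c_s σ J p hσ := h.ext fun μ => by
    simp only [h.s, h.c, exists_agreeOff_preimage hσ, iSup_exists, iSup_and]
    rw [iSup_comm]
    refine iSup_congr fun κ => ?_
    rw [iSup_comm]
    simp
  q_s σ J p hσ := h.ext fun μ => by
    simp only [h.s, h.q, exists_agreeOff_preimage hσ, iInf_exists, iInf_and]
    rw [iInf_comm]
    refine iInf_congr fun κ => ?_
    rw [iInf_comm]
    simp
  d_refl he k := h.ext fun σ => by rw [h.d, h.d_refl, h.one]
  s_d he τ k l := h.ext fun σ => by rw [h.s, h.d, h.d, finApp_mul, finApp_mul]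
  d_le he k l p := h.le_iff.2 fun σ => by
    rw [h.meet, h.d, h.s]
    exact h.d_le he k l p σ

end IsFunctionalRep

end PolyAlg

/-! ### Fresh coordinates and equality in dimension-complemented algebras. -/

namespace PolyAlg

variable {e : Bool} {α : Type u} {A : Type v}

/-- A polyadic Heyting algebra whose Heyting operations are those of a given instance. -/
structure IsLatticeGPHA [HeytingAlgebra A] (𝔄 : PolyAlg e α A) : Prop extends 𝔄.IsGPHA where
  join_eq : ∀ a b, 𝔄.join a b = a ⊔ b
  meet_eq : ∀ a b, 𝔄.meet a b = a ⊓ b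
  imp_eq : ∀ a b, 𝔄.imp a b = a ⇨ b
  zero_eq : 𝔄.zero = ⊥

/-- Every finite set of elements is independent of infinitely many coordinates. -/
def IsDimComplemented (𝔄 : PolyAlg e α A) : Prop :=
  ∀ T : Finset A, {k | ∀ t ∈ T, 𝔄.c {k} t = t}.Infinite

namespace IsGPHA

variable {𝔄 : PolyAlg e α A}

theorem q_eq_of_c_eq (h : 𝔄.IsGPHA) {J : Finset α} {a : A} (ha : 𝔄.c J a = a) :
    𝔄.q J a = a := by
  rw [← ha, h.q_c, ha]

theorem c_eq_of_q_eq (h : 𝔄.IsGPHA) {J : Finset α} {a : A} (ha : 𝔄.q J a = a) :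
    𝔄.c J a = a := by
  rw [← ha, h.c_q, ha]

/-- The axioms do not make `c ∅` the identity, but it is absorbed by any `c {k}`. -/
theorem c_empty_of_fixed (h : 𝔄.IsGPHA) {k : α} {a : A} (ha : 𝔄.c {k} a = a) :
    𝔄.c ∅ a = a := by
  classical
  calc 𝔄.c ∅ a = 𝔄.c (∅ ∪ {k}) a := by rw [h.c_union, ha]
    _ = a := by rw [Finset.empty_union, ha]

theorem c_eq_of_forall (h : 𝔄.IsGPHA) {a : A} (h₀ : 𝔄.c ∅ a = a) {K : Finset α}
    (hK : ∀ k ∈ K, 𝔄.c {k} a = a) : 𝔄.c K a = a := by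
  classical
  induction K using Finset.induction_on with
  | empty => exact h₀
  | insert k K _ ih =>
    rw [Finset.insert_eq, h.c_union, ih fun i hi => hK i (Finset.mem_insert_of_mem hi)]
    exact hK k (Finset.mem_insert_self _ _)

theorem c_comm (h : 𝔄.IsGPHA) (J K : Finset α) (a : A) :
    𝔄.c J (𝔄.c K a) = 𝔄.c K (𝔄.c J a) := by
  classical
  rw [← h.c_union, ← h.c_union, Finset.union_comm]

theorem q_comm (h : 𝔄.IsGPHA) (J K : Finset α) (a : A) :
    𝔄.q J (𝔄.q K a) = 𝔄.q K (𝔄.q J a) := by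
  classical
  rw [← h.q_union, ← h.q_union, Finset.union_comm]

theorem s_congr_of_fixed (h : 𝔄.IsGPHA) {J : Finset α} {a : A} (ha : 𝔄.c J a = a)
    {σ τ : FinTrans α} (hστ : AgreeOff J σ τ) : 𝔄.s σ a = 𝔄.s τ a := by
  rw [← ha]
  exact h.s_c σ τ J a hστ

theorem c_s_eq (h : 𝔄.IsGPHA) {σ : FinTrans α} {J K : Finset α} (a : A)
    (hinj : Set.InjOn (finApp σ) K) (hK : ∀ i, finApp σ i ∈ J ↔ i ∈ K) :
    𝔄.c J (𝔄.s σ a) = 𝔄.s σ (𝔄.c K a) := by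
  have hpre : finApp σ ⁻¹' (J : Set α) = K := Set.ext fun i => hK i
  have hin : Set.InjOn (finApp σ) (finApp σ ⁻¹' (J : Set α)) := by rwa [hpre]
  rw [h.c_s σ J a hin]
  congr
  ext i
  rw [Finset.mem_preimage, hK]

theorem q_s_eq (h : 𝔄.IsGPHA) {σ : FinTrans α} {J K : Finset α} (a : A)
    (hinj : Set.InjOn (finApp σ) K) (hK : ∀ i, finApp σ i ∈ J ↔ i ∈ K) :
    𝔄.q J (𝔄.s σ a) = 𝔄.s σ (𝔄.q K a) := by
  have hpre : finApp σ ⁻¹' (J : Set α) = K := Set.ext fun i => hK i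
  have hin : Set.InjOn (finApp σ) (finApp σ ⁻¹' (J : Set α)) := by rwa [hpre]
  rw [h.q_s σ J a hin]
  congr
  ext i
  rw [Finset.mem_preimage, hK]

end IsGPHA

theorem IsDimComplemented.exists_injOn [Infinite α] {𝔄 : PolyAlg e α A}
    (hdim : 𝔄.IsDimComplemented) (T : Finset A) (V J : Finset α) :
    ∃ g : α → α, Set.InjOn g J ∧ ∀ j ∈ J, g j ∉ V ∧ ∀ t ∈ T, 𝔄.c {g j} t = t := by
  have hF := (hdim T).sdiff V.finite_toSet
  obtain ⟨g, hg, hinj⟩ := J.finite_toSet.exists_injOn_of_encard_le (t := _ \ (V : Set α))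
    (by rw [hF.encard_eq]; exact le_top)
  exact ⟨g, hinj, fun j hj => ⟨(hg hj).2, (hg hj).1⟩⟩

/-- Quantification over `J` can be replaced by quantification over fresh coordinates. -/
theorem IsGPHA.exists_fresh_quantifier [Infinite α] {𝔄 : PolyAlg e α A} (h : 𝔄.IsGPHA)
    (hdim : 𝔄.IsDimComplemented) (T : Finset A) (J : Finset α) (σ : FinTrans α) (a : A) :
    ∃ (K : Finset α) (ν : FinTrans α), AgreeOff J ν σ ∧ (∀ t ∈ T, 𝔄.c K t = t) ∧
      𝔄.c K (𝔄.s ν a) = 𝔄.s σ (𝔄.c J a) ∧ 𝔄.q K (𝔄.s ν a) = 𝔄.s σ (𝔄.q J a) := by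
  classical
  let o : α := Classical.arbitrary α
  have hσ : {i | finApp σ i ≠ i}.Finite := σ.2
  -- The new coordinates avoid `J`, the images of points moved by `σ`, and the dummy point `o`. This
  -- makes `J` the full preimage of `K` under `ν'` below.
  obtain ⟨g, hinj, hg⟩ := hdim.exists_injOn (insert a T)
    (insert o (J ∪ hσ.toFinset.image (finApp σ))) J
  simp only [Finset.mem_insert, Finset.mem_union, Finset.mem_image, not_or, not_exists,
    Set.Finite.mem_toFinset, Set.mem_ofPred_eq, forall_eq_or_imp, not_and] at hg
  let K := J.image g
  let ν := modifyOn σ J g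
  -- Collapsing `K` to `o` removes the old points of `K` from the preimage of `K`. It does not
  -- affect `a`, which is independent of `K`.
  let ν' := modifyOn ν K fun _ => o
  have hT : ∀ t ∈ insert a T, 𝔄.c K t = t := fun t ht => by
    refine h.c_eq_of_forall ?_ fun k hk => ?_
    · obtain ⟨k, hk⟩ := (hdim {t}).nonempty
      exact h.c_empty_of_fixed (hk t (Finset.mem_singleton_self t))
    · obtain ⟨j, hj, rfl⟩ := Finset.mem_image.1 hk
      rcases Finset.mem_insert.1 ht with rfl | ht
      · exact (hg j hj).2.1
      · exact (hg j hj).2.2 t ht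
  have hJK : ∀ j ∈ J, j ∉ K := fun j hj hk => by
    obtain ⟨i, hi, rfl⟩ := Finset.mem_image.1 hk
    exact (hg i hi).1.2.1 hj
  have hν'J : ∀ j ∈ J, finApp ν' j = g j := fun j hj => by
    rw [modifyOn_of_notMem _ _ (hJK j hj), modifyOn_of_mem _ _ hj]
  have hpre : ∀ i, finApp ν' i ∈ K ↔ i ∈ J := fun i => by
    refine ⟨fun hi => ?_, fun hi => ?_⟩
    · by_contra hiJ
      by_cases hiK : i ∈ K
      · rw [modifyOn_of_mem _ _ hiK] at hi
        obtain ⟨j, hj, hjo⟩ := Finset.mem_image.1 hi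
        exact (hg j hj).1.1 hjo
      · rw [modifyOn_of_notMem _ _ hiK, modifyOn_of_notMem _ _ hiJ] at hi
        by_cases hi' : finApp σ i = i
        · exact hiK (hi' ▸ hi)
        · obtain ⟨j, hj, hjo⟩ := Finset.mem_image.1 hi
          exact (hg j hj).1.2.2 i hi' hjo.symm
    · rw [hν'J i hi]
      exact Finset.mem_image_of_mem g hi
  have hinj' : Set.InjOn (finApp ν') J := fun i hi j hj hij => by
    rw [hν'J i hi, hν'J j hj] at hij
    exact hinj hi hj hij
  have ha : 𝔄.c K a = a := hT a (Finset.mem_insert_self _ _)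
  have hνν' : 𝔄.s ν a = 𝔄.s ν' a := h.s_congr_of_fixed ha (agreeOff_modifyOn ν K _).symm
  have hoff : AgreeOff (J ∪ K) ν' σ :=
    exists_agreeOff_union.2 ⟨ν, agreeOff_modifyOn σ J g, agreeOff_modifyOn ν K _⟩
  refine ⟨K, ν, agreeOff_modifyOn σ J g, fun t ht => hT t (Finset.mem_insert_of_mem ht), ?_, ?_⟩
  · rw [hνν', h.c_s_eq a hinj' hpre]
    have : 𝔄.c (J ∪ K) a = 𝔄.c J a := by rw [h.c_union, ha]
    rw [← this]
    exact h.s_c ν' σ _ a hoff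
  · rw [hνν', h.q_s_eq a hinj' hpre]
    have : 𝔄.q (J ∪ K) a = 𝔄.q J a := by rw [h.q_union, h.q_eq_of_c_eq ha]
    rw [← this]
    exact h.s_q ν' σ _ a hoff

namespace IsLatticeGPHA

variable [HeytingAlgebra A] {𝔄 : PolyAlg e α A}

theorem le_iff (h : 𝔄.IsLatticeGPHA) {a b : A} : 𝔄.le a b ↔ a ≤ b := by
  rw [PolyAlg.le, h.meet_eq, inf_eq_left]

theorem one_eq (h : 𝔄.IsLatticeGPHA) : 𝔄.one = ⊤ := by
  rw [PolyAlg.one, h.imp_eq, himp_self]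

theorem s_inf (h : 𝔄.IsLatticeGPHA) (τ : FinTrans α) (a b : A) :
    𝔄.s τ (a ⊓ b) = 𝔄.s τ a ⊓ 𝔄.s τ b := by
  rw [← h.meet_eq, ← h.meet_eq, (h.s_end τ).meet]

theorem s_mono (h : 𝔄.IsLatticeGPHA) (τ : FinTrans α) {a b : A} (hab : a ≤ b) :
    𝔄.s τ a ≤ 𝔄.s τ b := by
  rw [← inf_eq_left, ← h.s_inf, inf_eq_left.2 hab]

theorem q_mono (h : 𝔄.IsLatticeGPHA) (J : Finset α) {a b : A} (hab : a ≤ b) :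
    𝔄.q J a ≤ 𝔄.q J b := by
  have := h.le_iff.1 ((h.q_univ J).imp a b)
  rwa [h.imp_eq, h.imp_eq, himp_eq_top_iff.2 hab, ← h.one_eq, (h.q_univ J).one, h.one_eq,
    top_le_iff, himp_eq_top_iff] at this

theorem isQuantifierPair (h : 𝔄.IsLatticeGPHA) (J : Finset α) :
    IsQuantifierPair (𝔄.c J) (𝔄.q J) where
  le_c a := h.le_iff.1 ((h.c_ex J).le a)
  c_le a t ht hat := by
    have := (h.c_ex J).meet a t
    rw [h.meet_eq, h.meet_eq, ht, inf_eq_left.2 hat] at this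
    rw [this]
    exact inf_le_right
  c_c := (h.c_ex J).idem
  q_le a := h.le_iff.1 ((h.q_univ J).le a)
  le_q a t ht hta := by
    rw [← h.q_eq_of_c_eq ht]
    exact h.q_mono J hta
  c_q := h.c_q J
  inf a b ha hb := by
    have := (h.c_ex J).meet a b
    rwa [hb, ha, h.meet_eq] at this
  himp a b ha hb := by
    have := (h.c_ex J).imp a b
    rwa [hb, ha, h.imp_eq] at this

theorem d_self (h : 𝔄.IsLatticeGPHA) (he : e = true) (k : α) : 𝔄.d he k k = ⊤ := by
  rw [h.d_refl, h.one_eq]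

theorem inf_d_le (h : 𝔄.IsLatticeGPHA) (he : e = true) (k l : α) (p : A) :
    p ⊓ 𝔄.d he k l ≤ 𝔄.s (FinTrans.repl k l) p := by
  rw [← h.meet_eq, ← h.le_iff]
  exact h.d_le he k l p

/-- Replacement under an arbitrary substitution. -/
theorem s_inf_d_le [Infinite α] (h : 𝔄.IsLatticeGPHA) (hdim : 𝔄.IsDimComplemented)
    (he : e = true) (σ : FinTrans α) (k l : α) (a : A) :
    𝔄.s σ a ⊓ 𝔄.d he (finApp σ k) l ≤ 𝔄.s (modifyOn σ {k} fun _ => l) a := by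
  classical
  have hσ : {i | finApp σ i ≠ i}.Finite := σ.2
  -- Replacing `σ k` directly could alter other points with the same image. So `k` is first sent to
  -- a fresh `m`, replacement is applied at `m`, and `m` is then specialised to `σ k`.
  obtain ⟨m, hm, hmV⟩ := (hdim {a}).exists_notMem_finset
    ({k, l} ∪ hσ.toFinset.image (finApp σ))
  simp only [Finset.mem_insert, Finset.mem_union, Finset.mem_image, not_or, not_exists,
    Set.Finite.mem_toFinset, Set.mem_ofPred_eq, Finset.mem_singleton, not_and] at hm hmV
  have hma : 𝔄.c {m} a = a := hm a rfl
  obtain ⟨⟨hmk, hml⟩, hmσ⟩ := hmV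
  have hne : ∀ i, i ≠ m → finApp σ i ≠ m := fun i hi him => by
    by_cases hi' : finApp σ i = i
    · exact hi (hi'.symm.trans him)
    · exact hmσ i hi' him
  let τ := modifyOn σ {k} fun _ => m
  have key : ∀ x, 𝔄.s (FinTrans.repl m x) (𝔄.s τ a) =
      𝔄.s (modifyOn σ {k} fun _ => x) a := fun x => by
    rw [← h.s_mul]
    refine h.s_congr_of_fixed hma fun i hi => ?_
    rw [Finset.mem_singleton] at hi
    rw [finApp_mul, finApp_repl]
    by_cases hik : i = k
    · have hik : i ∈ ({k} : Finset α) := Finset.mem_singleton.2 hik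
      rw [modifyOn_of_mem _ _ hik, modifyOn_of_mem _ _ hik, if_pos rfl]
    · have hik : i ∉ ({k} : Finset α) := by rwa [Finset.mem_singleton]
      rw [modifyOn_of_notMem _ _ hik, modifyOn_of_notMem _ _ hik, if_neg (hne i hi)]
  have hσk : (modifyOn σ {k} fun _ => finApp σ k) = σ := finApp_ext fun i => by
    by_cases hik : i ∈ ({k} : Finset α)
    · rw [modifyOn_of_mem _ _ hik, Finset.mem_singleton.1 hik]
    · rw [modifyOn_of_notMem _ _ hik]
  have hrr : FinTrans.repl m (finApp σ k) * FinTrans.repl m l = FinTrans.repl m l :=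
    finApp_ext fun i => by
      rw [finApp_mul, finApp_repl m l]
      split_ifs with him
      · rw [finApp_repl, if_neg (Ne.symm hml)]
      · rw [finApp_repl, if_neg him]
  have := h.s_mono (FinTrans.repl m (finApp σ k)) (h.inf_d_le he m l (𝔄.s τ a))
  rwa [h.s_inf, h.s_d, ← h.s_mul _ (FinTrans.repl m l), hrr, key, key, hσk, finApp_repl, if_pos rfl, finApp_repl,
    if_neg (Ne.symm hml)] at this

/-- Replace `m` by `l` in `d m k` for a fresh `m`, then substitute `k` for `m`. -/
theorem d_symm [Infinite α] (h : 𝔄.IsLatticeGPHA) (he : e = true) (k l : α) :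
    𝔄.d he k l ≤ 𝔄.d he l k := by
  classical
  obtain ⟨m, hm⟩ := Infinite.exists_notMem_finset ({k, l} : Finset α)
  rw [Finset.mem_insert, Finset.mem_singleton, not_or] at hm
  have := h.s_mono (FinTrans.repl m k) (h.inf_d_le he m l (𝔄.d he m k))
  simpa [h.s_inf, h.s_d, finApp_repl, Ne.symm hm.1, Ne.symm hm.2, h.d_self] using this

theorem d_trans (h : 𝔄.IsLatticeGPHA) (he : e = true) (k l m : α) :
    𝔄.d he k l ⊓ 𝔄.d he l m ≤ 𝔄.d he k m := by
  by_cases hkl : k = l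
  · rw [hkl]
    exact inf_le_right
  · simpa [h.s_d, finApp_repl, hkl] using h.inf_d_le he l m (𝔄.d he k l)

/-- Replacement applied to `q ∅ (d k m)`, followed by `m ↦ k`, bounds `d k l` by `q ∅ (d l k)`,
because `q ∅` commutes with substitutions and preserves the unit. Symmetry finishes. -/
theorem c_empty_d [Infinite α] (h : 𝔄.IsLatticeGPHA) (he : e = true) (i j : α) :
    𝔄.c ∅ (𝔄.d he i j) = 𝔄.d he i j := by
  classical
  have key : ∀ k l, 𝔄.d he k l ≤ 𝔄.q ∅ (𝔄.d he l k) := fun k l => by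
    obtain ⟨m, hm⟩ := Infinite.exists_notMem_finset ({k, l} : Finset α)
    rw [Finset.mem_insert, Finset.mem_singleton, not_or] at hm
    have hq : ∀ σ p, 𝔄.s σ (𝔄.q ∅ p) = 𝔄.q ∅ (𝔄.s σ p) := fun σ p =>
      (h.q_s_eq p (by simp) (by simp)).symm
    have hq₁ : 𝔄.q ∅ ⊤ = ⊤ := by rw [← h.one_eq, (h.q_univ ∅).one]
    have := h.s_mono (FinTrans.repl m k) (h.inf_d_le he k l (𝔄.q ∅ (𝔄.d he k m)))
    simpa [h.s_inf, hq, h.s_d, finApp_repl, Ne.symm hm.1, Ne.symm hm.2, hm.1, h.d_self, hq₁]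
      using this
  refine h.c_eq_of_q_eq (le_antisymm ((h.isQuantifierPair ∅).q_le _) ?_)
  exact (h.d_symm he i j).trans (key j i)

/-- The substitution `[k|i]` fixes this diagonal and never takes the value `k`, so the quantifier
over `k` turns into `c ∅`. -/
theorem c_d [Infinite α] (h : 𝔄.IsLatticeGPHA) (he : e = true) {k i j : α} (hi : k ≠ i)
    (hj : k ≠ j) : 𝔄.c {k} (𝔄.d he i j) = 𝔄.d he i j := by
  have hs : 𝔄.s (FinTrans.repl k i) (𝔄.d he i j) = 𝔄.d he i j := by
    rw [h.s_d, finApp_repl, finApp_repl, if_neg hi.symm, if_neg hj.symm]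
  rw [← hs, h.c_s_eq (K := ∅) _ (by simp), h.c_empty_d]
  intro l
  rw [finApp_repl]
  split_ifs with hl
  · simp [hi.symm]
  · simp [hl]

/-- The value of the equality of two finite transformations bounds replacement. -/
theorem interpEmb_s_inf_iInf_d_le [Infinite α] (h : 𝔄.IsLatticeGPHA)
    (hdim : 𝔄.IsDimComplemented) {S : Set A} (hS : IsHeytingSub S) (he : e = true) (b : Bool)
    (a : A) (σ σ' : FinTrans α) :
    interpEmb S b (𝔄.s σ a) ⊓ ⨅ i, interpEmb S b (𝔄.d he (finApp σ i) (finApp σ' i)) ≤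
      interpEmb S b (𝔄.s σ' a) := by
  classical
  -- The transformations differ at finitely many points, which are corrected one at a time; a
  -- corrected point contributes `⊤` to the infimum.
  have key : ∀ (J : Finset α) (σ : FinTrans α), AgreeOff J σ σ' →
      interpEmb S b (𝔄.s σ a) ⊓ ⨅ i, interpEmb S b (𝔄.d he (finApp σ i) (finApp σ' i)) ≤
        interpEmb S b (𝔄.s σ' a) := fun J => by
    induction J using Finset.induction_on with
    | empty =>
      intro σ hσ
      rw [finApp_ext fun i => hσ i (Finset.notMem_empty i)]
      exact inf_le_left
    | insert k J _ ih =>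
      intro σ hσ
      refine le_trans (le_inf ?_ ?_) (ih (modifyOn σ {k} fun _ => finApp σ' k) ?_)
      · refine (inf_le_inf_left _ (iInf_le _ k)).trans ?_
        rw [← interpEmb_inf hS]
        exact interpEmb_mono b (h.s_inf_d_le hdim he σ k _ a)
      · refine inf_le_right.trans (iInf_mono fun i => ?_)
        by_cases hik : i ∈ ({k} : Finset α)
        · rw [modifyOn_of_mem _ _ hik, Finset.mem_singleton.1 hik, h.d_self, interpEmb_top hS]
          exact le_top
        · rw [modifyOn_of_notMem _ _ hik]
      · intro i hi
        by_cases hik : i ∈ ({k} : Finset α)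
        · rw [modifyOn_of_mem _ _ hik, Finset.mem_singleton.1 hik]
        · rw [modifyOn_of_notMem _ _ hik]
          exact hσ i (by simp_all)
  refine key ((σ.2.union σ'.2 : ({i | finApp σ i ≠ i} ∪ {i | finApp σ' i ≠ i}).Finite).toFinset)
    σ fun i hi => ?_
  simp only [Set.Finite.mem_toFinset, Set.mem_union, Set.mem_ofPred_eq, not_or, not_not] at hi
  exact Eq.trans hi.1 hi.2.symm

variable {S : Set A}

/-- Each `s ν a` lies below the quantified element. Conversely, for given test elements, a member
`ν` with fresh values on `J` has a quantification equal to the whole left side. -/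
theorem interpEmb_s_c [Infinite α] (h : 𝔄.IsLatticeGPHA) (hdim : 𝔄.IsDimComplemented)
    (hS : IsHeytingSub S) (hc : ∀ J, ∀ i ∈ S, 𝔄.c J i ∈ S) (hq : ∀ J, ∀ i ∈ S, 𝔄.q J i ∈ S)
    (b : Bool) (J : Finset α) (σ : FinTrans α) (a : A) :
    interpEmb S b (𝔄.s σ (𝔄.c J a)) =
      ⨆ (ν) (_ : AgreeOff J ν σ), interpEmb S b (𝔄.s ν a) := by
  classical
  refine le_antisymm ?_ (iSup₂_le fun ν hν => interpEmb_mono b ?_)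
  · rw [iSup_subtype']
    refine interpEmb_le_iSup hS b _ _ fun x y t => ?_
    obtain ⟨K, ν, hν, hT, hK, -⟩ := h.exists_fresh_quantifier hdim {x, y, t} J σ a
    exact ⟨⟨ν, hν⟩, 𝔄.c K, 𝔄.q K, h.isQuantifierPair K, hc K, hq K, hT x (by simp),
      hT y (by simp), hT t (by simp), hK.ge⟩
  · rw [← h.s_c ν σ J a hν]
    exact h.s_mono ν ((h.isQuantifierPair J).le_c a)

theorem interpEmb_s_q [Infinite α] (h : 𝔄.IsLatticeGPHA) (hdim : 𝔄.IsDimComplemented)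
    (hq : ∀ J, ∀ i ∈ S, 𝔄.q J i ∈ S) (b : Bool) (J : Finset α) (σ : FinTrans α) (a : A) :
    interpEmb S b (𝔄.s σ (𝔄.q J a)) =
      ⨅ (ν) (_ : AgreeOff J ν σ), interpEmb S b (𝔄.s ν a) := by
  classical
  refine le_antisymm (le_iInf₂ fun ν hν => interpEmb_mono b ?_) ?_
  · rw [← h.s_q ν σ J a hν]
    exact h.s_mono ν ((h.isQuantifierPair J).q_le a)
  · rw [iInf_subtype']
    refine iInf_le_interpEmb b _ _ fun x y => ?_
    obtain ⟨K, ν, hν, hT, -, hK⟩ := h.exists_fresh_quantifier hdim {x, y} J σ a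
    exact ⟨⟨ν, hν⟩, 𝔄.c K, 𝔄.q K, h.isQuantifierPair K, hq K, hT x (by simp),
      hT y (by simp), hK.le⟩

end IsLatticeGPHA

end PolyAlg

/-! ### The full functional algebra and extensional assignments. -/

section FunctionalAlgebra

variable {e : Bool} {α : Type u} {δ : Type v} {C : Type*} [Order.Frame C]

/-- The algebra of all functions from the finite transformations to a frame, with diagonal
constants given by a `C`-valued relation `D`. -/
def functionalAlg (D : e = true → α → α → C) : PolyAlg e α (FinTrans α → C) where
  join F G := fun σ => F σ ⊔ G σ
  meet F G := fun σ => F σ ⊓ G σ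
  imp F G := fun σ => F σ ⇨ G σ
  zero := fun _ => ⊥
  s τ F := fun σ => F (σ * τ)
  c J F := fun σ => ⨆ (ν) (_ : AgreeOff J ν σ), F ν
  q J F := fun σ => ⨅ (ν) (_ : AgreeOff J ν σ), F ν
  d he k l := fun σ => D he (finApp σ k) (finApp σ l)

/-- The value of a word in an algebra under an assignment of the variables. -/
def PolyWord.eval {B : Type*} (𝔅 : PolyAlg e α B) (f : δ → B) : PolyWord e α δ → B
  | .var η => f η
  | .join a b => 𝔅.join (a.eval 𝔅 f) (b.eval 𝔅 f)
  | .meet a b => 𝔅.meet (a.eval 𝔅 f) (b.eval 𝔅 f)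
  | .imp a b => 𝔅.imp (a.eval 𝔅 f) (b.eval 𝔅 f)
  | .zero => 𝔅.zero
  | .s τ a => 𝔅.s τ (a.eval 𝔅 f)
  | .c J a => 𝔅.c J (a.eval 𝔅 f)
  | .q J a => 𝔅.q J (a.eval 𝔅 f)
  | .d he i j => 𝔅.d he i j

theorem isCon_ker_eval {B : Type*} (𝔅 : PolyAlg e α B) (f : δ → B) :
    (absFree e α δ).IsCon (Setoid.ker (PolyWord.eval 𝔅 f)) where
  join _ _ _ _ ha hb := congrArg₂ 𝔅.join ha hb
  meet _ _ _ _ ha hb := congrArg₂ 𝔅.meet ha hb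
  imp _ _ _ _ ha hb := congrArg₂ 𝔅.imp ha hb
  s τ _ _ ha := congrArg (𝔅.s τ) ha
  c J _ _ ha := congrArg (𝔅.c J) ha
  q J _ _ ha := congrArg (𝔅.q J) ha

/-- `D` is a family of `C`-valued equality relations. -/
structure IsValuedEquality (D : e = true → α → α → C) : Prop where
  refl : ∀ he k, D he k k = ⊤
  symm : ∀ he k l, D he k l ≤ D he l k
  trans : ∀ he k l m, D he k l ⊓ D he l m ≤ D he k m

/-- `F` respects the equality `D`. -/
def IsExtensional (D : e = true → α → α → C) (F : FinTrans α → C) : Prop :=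
  ∀ he σ σ', F σ ⊓ ⨅ i, D he (finApp σ i) (finApp σ' i) ≤ F σ'

theorem iInf_modifyOn_le {D : e = true → α → α → C} (hD : IsValuedEquality D) (he : e = true)
    (J : Finset α) {ν σ σ' : FinTrans α} (hν : AgreeOff J ν σ) :
    ⨅ i, D he (finApp σ i) (finApp σ' i) ≤
      ⨅ i, D he (finApp ν i) (finApp (modifyOn σ' J (finApp ν)) i) := by
  refine iInf_mono fun i => ?_
  by_cases hi : i ∈ J
  · rw [modifyOn_of_mem _ _ hi, hD.refl]
    exact le_top
  · rw [modifyOn_of_notMem _ _ hi, hν i hi]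

/-- The replacement law can fail for arbitrary functions. It is needed only for values of words, and
these inherit extensionality from the generators. -/
theorem isExtensional_eval {D : e = true → α → α → C} (hD : IsValuedEquality D)
    {f : δ → FinTrans α → C} (hf : ∀ η, IsExtensional D (f η)) (w : PolyWord e α δ) :
    IsExtensional D (w.eval (functionalAlg D) f) := by
  have hsymm : ∀ he (σ σ' : FinTrans α), ⨅ i, D he (finApp σ i) (finApp σ' i) ≤
      ⨅ i, D he (finApp σ' i) (finApp σ i) := fun he σ σ' => iInf_mono fun i => hD.symm he _ _
  induction w with
  | var η => exact hf η
  | join a b iha ihb =>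
    intro he σ σ'
    show (_ ⊔ _) ⊓ _ ≤ _ ⊔ _
    rw [inf_sup_right]
    exact sup_le_sup (iha he σ σ') (ihb he σ σ')
  | meet a b iha ihb =>
    intro he σ σ'
    show (_ ⊓ _) ⊓ _ ≤ _ ⊓ _
    exact le_inf ((inf_le_inf_right _ inf_le_left).trans (iha he σ σ'))
      ((inf_le_inf_right _ inf_le_right).trans (ihb he σ σ'))
  | imp a b iha ihb =>
    intro he σ σ'
    show (_ ⇨ _) ⊓ _ ≤ _ ⇨ _
    rw [le_himp_iff, inf_assoc]
    refine le_trans (le_inf ?_ (inf_le_right.trans inf_le_left)) (ihb he σ σ')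
    refine le_trans (inf_le_inf_left _ ?_) himp_inf_le
    rw [inf_comm]
    exact (inf_le_inf_left _ (hsymm he σ σ')).trans (iha he σ' σ)
  | zero =>
    intro he σ σ'
    exact inf_le_left
  | s τ a ih =>
    intro he σ σ'
    refine le_trans (inf_le_inf_left _ ?_) (ih he (σ * τ) (σ' * τ))
    exact le_iInf fun i => iInf_le _ (finApp τ i)
  | c J a ih =>
    intro he σ σ'
    show (⨆ (ν) (_ : AgreeOff J ν σ), _) ⊓ _ ≤ ⨆ (ν) (_ : AgreeOff J ν σ'), _
    rw [iSup₂_inf_eq]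
    refine iSup₂_le fun ν hν => ?_
    -- The witness for `σ'` copies `ν` on `J`, where the equality becomes `⊤`; elsewhere the old
    -- equality is retained.
    refine le_iSup₂_of_le (modifyOn σ' J (finApp ν)) (agreeOff_modifyOn _ _ _) ?_
    exact (inf_le_inf_left _ (iInf_modifyOn_le hD he J hν)).trans (ih he _ _)
  | q J a ih =>
    intro he σ σ'
    refine le_iInf₂ fun ν hν => ?_
    refine le_trans (inf_le_inf ?_ ?_) (ih he (modifyOn σ J (finApp ν)) ν)
    · exact iInf₂_le (f := fun ν (_ : AgreeOff J ν σ) => a.eval (functionalAlg D) f ν)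
        (modifyOn σ J (finApp ν)) (agreeOff_modifyOn _ _ _)
    · exact ((hsymm he σ σ').trans (iInf_modifyOn_le hD he J hν)).trans (hsymm he _ _)
  | d he' k l =>
    intro he σ σ'
    show D he' (finApp σ k) (finApp σ l) ⊓ _ ≤ D he' (finApp σ' k) (finApp σ' l)
    have h₁ : D he (finApp σ k) (finApp σ l) ⊓ ⨅ i, D he (finApp σ i) (finApp σ' i) ≤
        D he (finApp σ k) (finApp σ' l) :=
      (inf_le_inf_left _ (iInf_le _ l)).trans (hD.trans he _ _ _)
    refine le_trans (le_inf ?_ h₁) (hD.trans he _ (finApp σ k) _)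
    exact (inf_le_right.trans (iInf_le _ k)).trans (hD.symm he _ _)

/-- Extensional assignments of functions that depend only on the coordinates allowed by `ρ` give
congruences of the kind defining the dimension-restricted free algebra. -/
theorem isRestrictedCon_ker_eval {D : e = true → α → α → C} (hD : IsValuedEquality D)
    {f : δ → FinTrans α → C} (hf : ∀ η, IsExtensional D (f η)) {ρ : δ → Set α}
    (hρ : ∀ η k, k ∉ ρ η → ∀ ν σ, AgreeOff {k} ν σ → f η ν = f η σ) :
    IsRestrictedCon e ρ (Setoid.ker (PolyWord.eval (functionalAlg D) f)) := by
  classical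
  refine ⟨isCon_ker_eval _ f, ?_, fun η k hk => funext fun σ => ?_⟩
  · refine PolyAlg.IsFunctionalRep.isGPHA (D := D)
      (φ := Quotient.lift (PolyWord.eval (functionalAlg D) f) fun _ _ h => h) ?_
    exact
      { inj := by
          rintro ⟨a⟩ ⟨b⟩ hab
          exact Quotient.sound hab
        join := by
          rintro ⟨a⟩ ⟨b⟩ σ
          rfl
        meet := by
          rintro ⟨a⟩ ⟨b⟩ σ
          rfl
        imp := by
          rintro ⟨a⟩ ⟨b⟩ σ
          rfl
        zero := fun _ => rfl
        s := by
          rintro τ ⟨a⟩ σ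
          rfl
        c := by
          rintro J ⟨a⟩ σ
          rfl
        q := by
          rintro J ⟨a⟩ σ
          rfl
        d := fun _ _ _ _ => rfl
        d_refl := hD.refl
        d_le := by
          rintro he k l ⟨a⟩ σ
          -- The transformations `σ` and `σ * [k|l]` can differ only at `k`, so extensionality
          -- reduces to replacement.
          refine le_trans (inf_le_inf_left _ (le_iInf fun i => ?_))
            (isExtensional_eval hD hf a he σ (σ * FinTrans.repl k l))
          rw [finApp_mul, finApp_repl]
          split_ifs with hik
          · rw [hik]
          · rw [hD.refl]
            exact le_top }
  · show ⨆ (ν) (_ : AgreeOff {k} ν σ), f η ν = f η σ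
    exact le_antisymm (iSup₂_le fun ν hν => (hρ η k hk ν σ hν).le)
      (le_iSup₂_of_le σ (AgreeOff.refl _ σ) le_rfl)

end FunctionalAlgebra

/-! ### Laws and finite supports in the dimension-restricted free algebra. -/

section DimFreeAlgebra

variable {e : Bool} {α : Type u} {δ : Type v} {ρ : δ → Set α}

theorem dimFree_mk_eq {w w' : PolyWord e α δ}
    (h : ∀ (R : Setoid (PolyWord e α δ)) (hR : (absFree e α δ).IsCon R),
      ((absFree e α δ).quot R hR).IsGPHA → Quotient.mk R w = Quotient.mk R w') :
    (Quotient.mk (restrictedCr e ρ) w : DimFree e ρ) = Quotient.mk (restrictedCr e ρ) w' := by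
  refine Quotient.sound fun R hR => ?_
  obtain ⟨hR, hG, -⟩ := hR
  exact Quotient.exact (h R hR hG)

/-- The free algebra embeds in the product of its admissible quotients, each of which is a Heyting
algebra. -/
theorem isHeyting_dimFree : (dimFree e ρ).IsHeyting := by
  have hH : ∀ R : {R // IsRestrictedCon e ρ R}, ∃ _ : HeytingAlgebra (Quotient R.1),
      (∀ a b, Quotient.mk R.1 (.join a b) = Quotient.mk R.1 a ⊔ Quotient.mk R.1 b) ∧
      (∀ a b, Quotient.mk R.1 (.meet a b) = Quotient.mk R.1 a ⊓ Quotient.mk R.1 b) ∧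
      (∀ a b, Quotient.mk R.1 (.imp a b) = Quotient.mk R.1 a ⇨ Quotient.mk R.1 b) ∧
      Quotient.mk R.1 .zero = ⊥ := by
    rintro ⟨R, hR, hG, -⟩
    obtain ⟨inst, hj, hm, hi, hz⟩ := hG.heyting
    exact ⟨inst, fun a b => hj (Quotient.mk R a) (Quotient.mk R b),
      fun a b => hm (Quotient.mk R a) (Quotient.mk R b),
      fun a b => hi (Quotient.mk R a) (Quotient.mk R b), hz⟩
  choose inst hj hm hi hz using hH
  refine PolyAlg.isHeyting_of_injective (dimFree e ρ)
    (B := ∀ R : {R // IsRestrictedCon e ρ R}, Quotient R.1)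
    (Quotient.lift (fun w R => Quotient.mk R.1 w) fun a b hab => funext fun R =>
      Quotient.sound (hab R.1 R.2)) ?_ ?_ ?_ ?_ ?_
  · rintro ⟨a⟩ ⟨b⟩ hab
    exact Quotient.sound fun R hR => Quotient.exact (congrFun hab ⟨R, hR⟩)
  · rintro ⟨a⟩ ⟨b⟩
    exact funext fun R => hj R a b
  · rintro ⟨a⟩ ⟨b⟩
    exact funext fun R => hm R a b
  · rintro ⟨a⟩ ⟨b⟩
    exact funext fun R => hi R a b
  · exact funext fun R => hz R

/-- The dimension-restricted free algebra belongs to the class it is free for. -/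
theorem isGPHA_dimFree : (dimFree e ρ).IsGPHA where
  heyting := isHeyting_dimFree
  s_end τ :=
    { join := by
        rintro ⟨p⟩ ⟨r⟩
        exact dimFree_mk_eq fun R _ hG => (hG.s_end τ).join (Quotient.mk R p) (Quotient.mk R r)
      meet := by
        rintro ⟨p⟩ ⟨r⟩
        exact dimFree_mk_eq fun R _ hG => (hG.s_end τ).meet (Quotient.mk R p) (Quotient.mk R r)
      imp := by
        rintro ⟨p⟩ ⟨r⟩
        exact dimFree_mk_eq fun R _ hG => (hG.s_end τ).imp (Quotient.mk R p) (Quotient.mk R r)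
      zero := dimFree_mk_eq fun R _ hG => (hG.s_end τ).zero }
  c_ex J :=
    { zero := dimFree_mk_eq fun R _ hG => (hG.c_ex J).zero
      le := by
        rintro ⟨p⟩
        exact dimFree_mk_eq fun R _ hG => (hG.c_ex J).le (Quotient.mk R p)
      meet := by
        rintro ⟨p⟩ ⟨r⟩
        exact dimFree_mk_eq fun R _ hG => (hG.c_ex J).meet (Quotient.mk R p) (Quotient.mk R r)
      imp := by
        rintro ⟨p⟩ ⟨r⟩
        exact dimFree_mk_eq fun R _ hG => (hG.c_ex J).imp (Quotient.mk R p) (Quotient.mk R r)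
      join := by
        rintro ⟨p⟩ ⟨r⟩
        exact dimFree_mk_eq fun R _ hG => (hG.c_ex J).join (Quotient.mk R p) (Quotient.mk R r)
      idem := by
        rintro ⟨p⟩
        exact dimFree_mk_eq fun R _ hG => (hG.c_ex J).idem (Quotient.mk R p) }
  q_univ J :=
    { one := dimFree_mk_eq fun R _ hG => (hG.q_univ J).one
      le := by
        rintro ⟨p⟩
        exact dimFree_mk_eq fun R _ hG => (hG.q_univ J).le (Quotient.mk R p)
      imp := by
        rintro ⟨p⟩ ⟨r⟩
        exact dimFree_mk_eq fun R _ hG => (hG.q_univ J).imp (Quotient.mk R p) (Quotient.mk R r)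
      idem := by
        rintro ⟨p⟩
        exact dimFree_mk_eq fun R _ hG => (hG.q_univ J).idem (Quotient.mk R p) }
  s_one := by
    rintro ⟨p⟩
    exact dimFree_mk_eq fun R _ hG => hG.s_one (Quotient.mk R p)
  s_mul := by
    rintro σ τ ⟨p⟩
    exact dimFree_mk_eq fun R _ hG => hG.s_mul σ τ (Quotient.mk R p)
  c_union := by
    rintro J J' ⟨p⟩
    exact dimFree_mk_eq fun R _ hG => hG.c_union J J' (Quotient.mk R p)
  q_union := by
    rintro J J' ⟨p⟩
    exact dimFree_mk_eq fun R _ hG => hG.q_union J J' (Quotient.mk R p)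
  c_q := by
    rintro J ⟨p⟩
    exact dimFree_mk_eq fun R _ hG => hG.c_q J (Quotient.mk R p)
  q_c := by
    rintro J ⟨p⟩
    exact dimFree_mk_eq fun R _ hG => hG.q_c J (Quotient.mk R p)
  s_c := by
    rintro σ τ J ⟨p⟩ h
    exact dimFree_mk_eq fun R _ hG => hG.s_c σ τ J (Quotient.mk R p) h
  s_q := by
    rintro σ τ J ⟨p⟩ h
    exact dimFree_mk_eq fun R _ hG => hG.s_q σ τ J (Quotient.mk R p) h
  c_s := by
    rintro σ J ⟨p⟩ h
    exact dimFree_mk_eq fun R _ hG => hG.c_s σ J (Quotient.mk R p) h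
  q_s := by
    rintro σ J ⟨p⟩ h
    exact dimFree_mk_eq fun R _ hG => hG.q_s σ J (Quotient.mk R p) h
  d_refl := fun he k => dimFree_mk_eq fun R _ hG => hG.d_refl he k
  s_d := fun he τ k l => dimFree_mk_eq fun R _ hG => hG.s_d he τ k l
  d_le := by
    rintro he k l ⟨p⟩
    exact dimFree_mk_eq fun R _ hG => hG.d_le he k l (Quotient.mk R p)

theorem c_gen {η : δ} {k : α} (hk : k ∉ ρ η) :
    (dimFree e ρ).c {k} (DimFree.gen e ρ η) = DimFree.gen e ρ η := by
  refine Quotient.sound fun R hR => ?_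
  obtain ⟨-, -, h⟩ := hR
  exact h η k hk

theorem isRestrictedCon_eq {R : Setoid (PolyWord e α δ)} (hR : IsRestrictedCon e ρ R)
    {w w' : PolyWord e α δ} (hw : (Quotient.mk (restrictedCr e ρ) w : DimFree e ρ) =
      Quotient.mk (restrictedCr e ρ) w') : R w w' := Quotient.exact hw R hR

variable [HeytingAlgebra (DimFree e ρ)]

/-- Every element of the free algebra depends only on the coordinates of finitely many generators
and finitely many further ones. -/
theorem exists_finite_support [Infinite α] (h : (dimFree e ρ).IsLatticeGPHA) (a : DimFree e ρ) :
    ∃ (V : Finset α) (E : Finset δ), ∀ k, k ∉ V → (∀ η ∈ E, k ∉ ρ η) →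
      (dimFree e ρ).c {k} a = a := by
  classical
  obtain ⟨w, rfl⟩ := Quotient.exists_rep a
  have binary : ∀ (op : DimFree e ρ → DimFree e ρ → DimFree e ρ),
      (∀ k a b, (dimFree e ρ).c {k} a = a → (dimFree e ρ).c {k} b = b →
        (dimFree e ρ).c {k} (op a b) = op a b) → ∀ a b,
      (∃ (V : Finset α) (E : Finset δ), ∀ k, k ∉ V → (∀ η ∈ E, k ∉ ρ η) →
        (dimFree e ρ).c {k} a = a) →
      (∃ (V : Finset α) (E : Finset δ), ∀ k, k ∉ V → (∀ η ∈ E, k ∉ ρ η) →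
        (dimFree e ρ).c {k} b = b) →
      ∃ (V : Finset α) (E : Finset δ), ∀ k, k ∉ V → (∀ η ∈ E, k ∉ ρ η) →
        (dimFree e ρ).c {k} (op a b) = op a b := by
    rintro op hop a b ⟨V, E, ha⟩ ⟨V', E', hb⟩
    refine ⟨V ∪ V', E ∪ E', fun k hk hE => hop k a b (ha k ?_ ?_) (hb k ?_ ?_)⟩
    · exact fun hV => hk (Finset.mem_union_left _ hV)
    · exact fun η hη => hE η (Finset.mem_union_left _ hη)
    · exact fun hV => hk (Finset.mem_union_right _ hV)
    · exact fun η hη => hE η (Finset.mem_union_right _ hη)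
  induction w with
  | var η => exact ⟨∅, {η}, fun k _ hk => c_gen (hk η (Finset.mem_singleton_self η))⟩
  | join a b iha ihb =>
    refine binary (dimFree e ρ).join (fun k a b ha hb => ?_) _ _ iha ihb
    have := (h.c_ex {k}).join a b
    rwa [ha, hb] at this
  | meet a b iha ihb =>
    refine binary (dimFree e ρ).meet (fun k a b ha hb => ?_) _ _ iha ihb
    have := (h.c_ex {k}).meet a b
    rwa [ha, hb] at this
  | imp a b iha ihb =>
    refine binary (dimFree e ρ).imp (fun k a b ha hb => ?_) _ _ iha ihb
    have := (h.c_ex {k}).imp a b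
    rwa [ha, hb] at this
  | zero => exact ⟨∅, ∅, fun k _ _ => (h.c_ex {k}).zero⟩
  | s τ a ih =>
    obtain ⟨V, E, ha⟩ := ih
    have hτ : {i | finApp τ i ≠ i}.Finite := τ.2
    -- Excluding the moved points and their images makes `{k}` its own preimage under `τ`.
    refine ⟨V ∪ (hτ.toFinset ∪ hτ.toFinset.image (finApp τ)), E, fun k hk hE => ?_⟩
    simp only [Finset.mem_union, Finset.mem_image, Set.Finite.mem_toFinset, Set.mem_ofPred_eq,
      not_or, not_exists, not_and, not_not] at hk
    refine Eq.trans (h.c_s_eq (K := {k}) (Quotient.mk (restrictedCr e ρ) a) (by simp) fun i => ?_)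
      (congrArg ((dimFree e ρ).s τ) (ha k hk.1 hE))
    rw [Finset.mem_singleton, Finset.mem_singleton]
    refine ⟨fun hi => ?_, fun hi => hi ▸ hk.2.1⟩
    by_contra hik
    exact hk.2.2 i (fun h' => hik (h'.symm.trans hi)) hi
  | c J a ih =>
    obtain ⟨V, E, ha⟩ := ih
    refine ⟨V, E, fun k hk hE => ?_⟩
    exact (h.c_comm {k} J (Quotient.mk (restrictedCr e ρ) a)).trans
      (congrArg ((dimFree e ρ).c J) (ha k hk hE))
  | q J a ih =>
    obtain ⟨V, E, ha⟩ := ih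
    refine ⟨V, E, fun k hk hE => ?_⟩
    exact h.c_eq_of_q_eq ((h.q_comm {k} J (Quotient.mk (restrictedCr e ρ) a)).trans
      (congrArg ((dimFree e ρ).q J) (h.q_eq_of_c_eq (ha k hk hE))))
  | d he i j =>
    refine ⟨{i, j}, ∅, fun k hk _ => ?_⟩
    rw [Finset.mem_insert, Finset.mem_singleton, not_or] at hk
    exact h.c_d he hk.1 hk.2

/-- Finitely many elements involve only finitely many generators in all; infinitely many coordinates
escape these, and removing a finite set leaves infinitely many. -/
theorem isDimComplemented_dimFree [Infinite α] (h : (dimFree e ρ).IsLatticeGPHA)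
    (hρ : ∀ S : Finset δ, Set.Infinite (⋃ η ∈ S, ρ η)ᶜ) : (dimFree e ρ).IsDimComplemented := by
  classical
  intro T
  have key : ∃ (V : Finset α) (E : Finset δ), ∀ t ∈ T, ∀ k, k ∉ V → (∀ η ∈ E, k ∉ ρ η) →
      (dimFree e ρ).c {k} t = t := by
    choose V E hVE using exists_finite_support h
    refine ⟨T.biUnion V, T.biUnion E, fun t ht k hk hE => hVE t k (fun hV => hk ?_) fun η hη => ?_⟩
    · exact Finset.mem_biUnion.2 ⟨t, ht, hV⟩
    · exact hE η (Finset.mem_biUnion.2 ⟨t, ht, hη⟩)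
  obtain ⟨V, E, hVE⟩ := key
  refine ((hρ E).sdiff V.finite_toSet).mono fun k hk t ht => hVE t ht k hk.2 fun η hη hkη => ?_
  exact hk.1 (Set.mem_biUnion hη hkη)

theorem isHeytingSub_sg (h : (dimFree e ρ).IsLatticeGPHA) (X : Set (DimFree e ρ)) :
    IsHeytingSub ((dimFree e ρ).Sg X) where
  sup a ha b hb := h.join_eq a b ▸ .join a b ha hb
  inf a ha b hb := h.meet_eq a b ▸ .meet a b ha hb
  himp a ha b hb := h.imp_eq a b ▸ .imp a b ha hb
  bot := h.zero_eq ▸ .zero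

end DimFreeAlgebra

/-! ### Evaluation in the amalgam and the interpolation theorem. -/

section Interpolation

variable {e : Bool} {α : Type u} {δ : Type v} {ρ : δ → Set α} [HeytingAlgebra (DimFree e ρ)]

variable (ρ) in
/-- The equality of the free algebra with values in the amalgam over `S`. -/
def interpEq (S : Set (DimFree e ρ)) : e = true → α → α → interpLocale S :=
  fun he k l => interpEmb S true ((dimFree e ρ).d he k l)

open Classical in
/-- The assignment into the functional algebra over the amalgam: generators in `X` are sent along
the first embedding, the others along the second one. -/
noncomputable def interpAssign (S X : Set (DimFree e ρ)) (η : δ) : FinTrans α → interpLocale S :=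
  fun σ => interpEmb S (decide (DimFree.gen e ρ η ∈ X)) ((dimFree e ρ).s σ (DimFree.gen e ρ η))

theorem interpEmb_d (h : (dimFree e ρ).IsLatticeGPHA) {X : Set (DimFree e ρ)} (b : Bool)
    (he : e = true) (k l : α) :
    interpEmb ((dimFree e ρ).Sg X) b ((dimFree e ρ).d he k l) =
      interpEq ρ ((dimFree e ρ).Sg X) he k l :=
  interpEmb_eq_of_mem (isHeytingSub_sg h X) (.d he k l) b true

theorem isValuedEquality_interpEq [Infinite α] (h : (dimFree e ρ).IsLatticeGPHA)
    (X : Set (DimFree e ρ)) : IsValuedEquality (interpEq ρ ((dimFree e ρ).Sg X)) where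
  refl he k := by rw [interpEq, h.d_self, interpEmb_top (isHeytingSub_sg h X)]
  symm he k l := interpEmb_mono true (h.d_symm he k l)
  trans he k l m := by
    rw [interpEq, interpEq, ← interpEmb_inf (isHeytingSub_sg h X)]
    exact interpEmb_mono true (h.d_trans he k l m)

theorem isRestrictedCon_interpAssign [Infinite α] (h : (dimFree e ρ).IsLatticeGPHA)
    (hdim : (dimFree e ρ).IsDimComplemented) (X Y : Set (DimFree e ρ)) :
    IsRestrictedCon e ρ (Setoid.ker (PolyWord.eval
      (functionalAlg (interpEq ρ ((dimFree e ρ).Sg Y)))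
      (interpAssign ((dimFree e ρ).Sg Y) X))) := by
  refine isRestrictedCon_ker_eval (isValuedEquality_interpEq h Y) (fun η he σ σ' => ?_)
    fun η k hk ν σ hν => ?_
  · refine le_trans (inf_le_inf_left _ (iInf_mono fun i => ?_))
      (h.interpEmb_s_inf_iInf_d_le hdim (isHeytingSub_sg h Y) he _ _ σ σ')
    exact (interpEmb_d h _ he _ _).ge
  · rw [interpAssign, interpAssign, h.s_congr_of_fixed (c_gen hk) hν]

/-- Every element of the subalgebra generated by `Z` is the value of a word that is evaluated
in the amalgam along the embedding used for the generators in `Z`. -/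
theorem exists_word_of_mem_sg [Infinite α] (h : (dimFree e ρ).IsLatticeGPHA)
    (hdim : (dimFree e ρ).IsDimComplemented) {X Y Z : Set (DimFree e ρ)} (b : Bool)
    (hZ : Z ⊆ Set.range (DimFree.gen e ρ))
    (hb : ∀ η, DimFree.gen e ρ η ∈ Z → ∀ σ, interpAssign ((dimFree e ρ).Sg Y) X η σ =
      interpEmb _ b ((dimFree e ρ).s σ (DimFree.gen e ρ η)))
    {θ : DimFree e ρ} (hθ : θ ∈ (dimFree e ρ).Sg Z) :
    ∃ w : PolyWord e α δ, (Quotient.mk (restrictedCr e ρ) w : DimFree e ρ) = θ ∧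
      ∀ σ, w.eval (functionalAlg (interpEq ρ ((dimFree e ρ).Sg Y)))
        (interpAssign ((dimFree e ρ).Sg Y) X) σ = interpEmb _ b ((dimFree e ρ).s σ θ) := by
  have hS := isHeytingSub_sg h Y
  induction hθ with
  | of x hx =>
    obtain ⟨η, rfl⟩ := hZ hx
    exact ⟨.var η, rfl, hb η hx⟩
  | join x y _ _ ihx ihy =>
    obtain ⟨w, hwx, hw⟩ := ihx
    obtain ⟨w', hwy, hw'⟩ := ihy
    refine ⟨.join w w', congrArg₂ (dimFree e ρ).join hwx hwy, fun σ =>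
      (congrArg₂ (· ⊔ ·) (hw σ) (hw' σ)).trans ?_⟩
    rw [(h.s_end σ).join, h.join_eq, interpEmb_sup hS]
  | meet x y _ _ ihx ihy =>
    obtain ⟨w, hwx, hw⟩ := ihx
    obtain ⟨w', hwy, hw'⟩ := ihy
    refine ⟨.meet w w', congrArg₂ (dimFree e ρ).meet hwx hwy, fun σ =>
      (congrArg₂ (· ⊓ ·) (hw σ) (hw' σ)).trans ?_⟩
    rw [(h.s_end σ).meet, h.meet_eq, interpEmb_inf hS]
  | imp x y _ _ ihx ihy =>
    obtain ⟨w, hwx, hw⟩ := ihx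
    obtain ⟨w', hwy, hw'⟩ := ihy
    refine ⟨.imp w w', congrArg₂ (dimFree e ρ).imp hwx hwy, fun σ =>
      (congrArg₂ (· ⇨ ·) (hw σ) (hw' σ)).trans ?_⟩
    rw [(h.s_end σ).imp, h.imp_eq, interpEmb_himp hS]
  | zero =>
    refine ⟨.zero, rfl, fun σ => ?_⟩
    rw [(h.s_end σ).zero, h.zero_eq, interpEmb_bot hS]
    rfl
  | s τ x _ ih =>
    obtain ⟨w, hwx, hw⟩ := ih
    refine ⟨.s τ w, congrArg ((dimFree e ρ).s τ) hwx, fun σ => (hw (σ * τ)).trans ?_⟩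
    rw [h.s_mul]
  | c J x _ ih =>
    obtain ⟨w, hwx, hw⟩ := ih
    refine ⟨.c J w, congrArg ((dimFree e ρ).c J) hwx, fun σ => ?_⟩
    rw [h.interpEmb_s_c hdim hS (fun J i hi => .c J i hi) fun J i hi => .q J i hi]
    exact iSup_congr fun ν => iSup_congr fun _ => hw ν
  | q J x _ ih =>
    obtain ⟨w, hwx, hw⟩ := ih
    refine ⟨.q J w, congrArg ((dimFree e ρ).q J) hwx, fun σ => ?_⟩
    rw [h.interpEmb_s_q hdim (S := (dimFree e ρ).Sg Y) fun J i hi => .q J i hi]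
    exact iInf_congr fun ν => iInf_congr fun _ => hw ν
  | d he i j =>
    refine ⟨.d he i j, rfl, fun σ => ?_⟩
    rw [h.s_d, interpEmb_d h]
    rfl

end Interpolation

theorem mainTheorem3 (e : Bool) {α : Type*} [Infinite α] {δ : Type*} (ρ : δ → Set α)
    (hρ : ∀ S : Finset δ, Set.Infinite (⋃ η ∈ S, ρ η)ᶜ)
    (X₁ X₂ : Set (DimFree e ρ))
    (hX₁ : X₁ ⊆ Set.range (DimFree.gen e ρ)) (hX₂ : X₂ ⊆ Set.range (DimFree.gen e ρ))
    (θ₁ θ₂ : DimFree e ρ)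
    (hθ₁ : θ₁ ∈ (dimFree e ρ).Sg X₁) (hθ₂ : θ₂ ∈ (dimFree e ρ).Sg X₂)
    (hle : (dimFree e ρ).le θ₁ θ₂) :
    ∃ θ ∈ (dimFree e ρ).Sg (X₁ ∩ X₂), (dimFree e ρ).le θ₁ θ ∧ (dimFree e ρ).le θ θ₂ := by
  classical
  obtain ⟨inst, hj, hm, hi, hz⟩ := isHeyting_dimFree (e := e) (ρ := ρ)
  have h : (dimFree e ρ).IsLatticeGPHA :=
    { toIsGPHA := isGPHA_dimFree, join_eq := hj, meet_eq := hm, imp_eq := hi, zero_eq := hz }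
  have hdim := isDimComplemented_dimFree h hρ
  have hS := isHeytingSub_sg h (X₁ ∩ X₂)
  obtain ⟨w₁, hw₁, hv₁⟩ := exists_word_of_mem_sg h hdim (X := X₁) (Y := X₁ ∩ X₂) true hX₁
    (fun η hη σ => by rw [interpAssign, decide_eq_true_iff.2 hη]) hθ₁
  obtain ⟨w₂, hw₂, hv₂⟩ := exists_word_of_mem_sg h hdim (X := X₁) (Y := X₁ ∩ X₂) false hX₂
    (fun η hη σ => by
      by_cases hη₁ : DimFree.gen e ρ η ∈ X₁
      -- A common generator is assigned along the first embedding, but all its substitutions lie in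
      -- `S`, where the embeddings agree.
      · exact interpEmb_eq_of_mem hS (.s σ _ (.of _ ⟨hη₁, hη⟩)) _ _
      · rw [interpAssign, decide_eq_false_iff_not.2 hη₁]) hθ₂
  -- Freeness enters here: an equation in the free algebra holds under the mixed assignment. It is
  -- read at the identity transformation.
  have hker := congrFun (isRestrictedCon_eq (isRestrictedCon_interpAssign h hdim X₁ (X₁ ∩ X₂))
    (w := .meet w₁ w₂) (w' := w₁) (by
      refine Eq.trans ?_ hw₁.symm
      rw [← hw₁, ← hw₂] at hle
      exact hle.trans hw₁)) 1
  have hemb : interpEmb ((dimFree e ρ).Sg (X₁ ∩ X₂)) true θ₁ ≤ interpEmb _ (!true) θ₂ := by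
    have h₁ := hv₁ 1
    have h₂ := hv₂ 1
    rw [h.s_one] at h₁ h₂
    rw [Bool.not_true, ← h₁, ← h₂]
    exact inf_eq_left.1 hker
  obtain ⟨θ, hθ, hl, hr⟩ := exists_interpolant_of_interpEmb_le hS hemb
  exact ⟨θ, hθ, h.le_iff.2 hl, h.le_iff.2 hr⟩
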